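/- Fix $p\in[\tfrac12,1]$ and consider the following zero-sum repeated game. A system is in one of two states $\underline s,\bar s$; at each stage Player 1 plays $T$ or $B$ and Player 2 simultaneously plays $L$ or $R$. Player 1 wins $1$ if the state is $\underline s$ and the moves are $T,L$, or if the state is $\bar s$ and the moves are $B,R$; otherwise he wins $0$. After each stage the system stays in its state with probability $p$ and switches with probability $1-p$. Player 1 knows the current state and all past states and moves; Player 2 knows only the past moves. The initial state is $\underline s$ with probability $q$. A strategy gives, as a function of this information, the probability of playing $T$ (Player 1) or $L$ (Player 2). A strategy of Player 1 guarantees $v$ if against every strategy of Player 2 the lower limit of the expected average gain per stage is at least $v$; a strategy of Player 2 guarantees $v$ if against every strategy of Player 1 the upper limit is at most $v$. The number $v$ is the value if Player 1 can guarantee every $w<v$ and Player 2 every $w>v$. A strategy is optimal if the game has a value and the strategy guarantees it. Put $\gamma=2p-1$ and $$f_B(\theta)=\begin{cases}p\frac{2\theta-1}{\theta}+(1-p)\frac{1-\theta}{\theta}&\theta\ge\frac12\\ 1-p&\theta<\frac12\end{cases},\qquad f_T(\theta)=\begin{cases}p&\theta\ge\frac12\\ p\frac{\theta}{1-\theta}+(1-p)\frac{1-2\theta}{1-\theta}&\theta<\frac12\end{cases},$$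 and $\Phi(\theta)=f_B(\theta)$ if $\theta\ge\frac12$, $\Phi(\theta)=f_T(\theta)$ otherwise. An internal state $\theta$, started at $\theta_0$, is updated after each stage to $f_T(\theta)$ if Player 1 played $T$ and to $f_B(\theta)$ if he played $B$. The strategy $\sigma^*$ of Player 1 plays $T$ with probability $1$ (system in $\underline s$) or $\frac{1-2\theta}{1-\theta}$ (system in $\bar s$) if $\theta\le\frac12$, and with probability $\frac{1-\theta}{\theta}$ (system in $\underline s$) or $0$ (system in $\bar s$) if $\theta>\frac12$. The strategy $(x(\theta))_{\theta\in[1-p,p]}$ of Player 2 plays $L$ with probability $x(\theta)$, where $x$ is defined as follows. Let $$A(\theta)=\begin{pmatrix}p&1-p\\-\gamma&\gamma\end{pmatrix}\ (\theta>\tfrac12),\quad A(\theta)=\begin{pmatrix}\gamma&-\gamma\\1-p&p\end{pmatrix}\ (\theta<\tfrac12),\quad A(\tfrac12)=\tfrac12\begin{pmatrix}1-p&p\\1-p&p\end{pmatrix},$$ $$w(\theta)=\sum_{n\ge0}A(\theta)A(\Phi(\theta))\cdots A(\Phi^{n-1}(\theta))\begin{pmatrix}1\\1\end{pmatrix},\quad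 v=\frac1{p\,w_1(p)+(1-p)\,w_2(p)},\quad Z=\frac{(w_1(p)-w_2(p))v}{2},$$ $$\begin{pmatrix}G(\theta)\\H(\theta)\end{pmatrix}=(1-\gamma Z)\begin{pmatrix}1\\1\end{pmatrix}-v\,w(\theta),\qquad x(\theta)=\begin{cases}G(\theta)+v+\gamma Z&\theta>\frac12\\ \frac12&\theta=\frac12\\ 1-(H(\theta)+v+\gamma Z)&\theta<\frac12.\end{cases}$$ **Lemma.** If $\frac23\le p\le 0.719023$, then for every $q\in[0,1]$ and every $\theta_0\in[1-p,p]$, the strategy $\sigma^*$ started at $\theta_0$ is an optimal strategy of Player 1 and the strategy $(x(\theta))_{\theta\in[1-p,p]}$ started at $\theta_0$ is an optimal strategy of Player 2. -/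

import Mathlib

open Filter Set

namespace AsymGame

/-! ## The repeated game -/

/-- The two states of the system: `lo` is `s̲` and `hi` is `s̄`. -/
inductive Sys | lo | hi

/-- The actions of Player 1 (top, bottom). -/
inductive Act1 | T | B

/-- The actions of Player 2 (left, right). -/
inductive Act2 | L | R

/-- The other state. -/
def Sys.flip : Sys → Sys
  | .lo => .hi
  | .hi => .lo

/-- The winnings of Player 1 in one stage. -/
def stageGain : Sys → Act1 → Act2 → ℝ
  | .lo, .T, .L => 1
  | .hi, .B, .R => 1
  | _, _, _ => 0

/-- A strategy of Player 1: the probability of playing `T`, given the past states and moves of both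
players (most recent stage first) and the current state. -/
abbrev Strategy1 := List (Sys × Act1 × Act2) → Sys → ℝ

/-- A strategy of Player 2: the probability of playing `L`, given the past moves of both players
(most recent stage first). -/
abbrev Strategy2 := List (Act1 × Act2) → ℝ

/-- The values of a strategy of Player 1 are probabilities. -/
def IsStrategy1 (σ : Strategy1) : Prop := ∀ h s, σ h s ∈ Icc (0 : ℝ) 1

/-- The values of a strategy of Player 2 are probabilities. -/
def IsStrategy2 (τ : Strategy2) : Prop := ∀ h, τ h ∈ Icc (0 : ℝ) 1

/-- Expectation of a two-valued random variable: `a` with probability `w`, otherwise `b`. -/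
def mix (w a b : ℝ) : ℝ := w * a + (1 - w) * b

/-- `expGain p σ τ n h s` is the expected total gain of Player 1 over the next `n` stages, if the
past is `h`, the current state is `s`, the players draw their moves independently according to
`σ` and `τ`, and after every stage the system stays in its state with probability `p` and switches
with probability `1 - p`. -/
noncomputable def expGain (p : ℝ) (σ : Strategy1) (τ : Strategy2) :
    ℕ → List (Sys × Act1 × Act2) → Sys → ℝ
  | 0, _, _ => 0
  | n + 1, h, s =>
    let y := τ (h.map Prod.snd)
    let next : Act1 → Act2 → ℝ := fun a b =>
      stageGain s a b +
        mix p (expGain p σ τ n ((s, a, b) :: h) s) (expGain p σ τ n ((s, a, b) :: h) s.flip)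
    mix (σ h s) (mix y (next .T .L) (next .T .R)) (mix y (next .B .L) (next .B .R))

/-- The expected average gain per stage over the first `n` stages, if the initial state is `s̲`
with probability `q`. -/
noncomputable def avgGain (p q : ℝ) (σ : Strategy1) (τ : Strategy2) (n : ℕ) : ℝ :=
  mix q (expGain p σ τ n [] .lo) (expGain p σ τ n [] .hi) / n

/-- Against every strategy of Player 2, the lower limit of the expected average gain under `σ` is at
least `v`. -/
def Guarantees1 (p q : ℝ) (σ : Strategy1) (v : ℝ) : Prop :=
  ∀ τ, IsStrategy2 τ → ∀ ε > 0, ∀ᶠ n in atTop, v - ε ≤ avgGain p q σ τ n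

/-- Against every strategy of Player 1, the upper limit of the expected average gain under `τ` is at
most `v`. -/
def Guarantees2 (p q : ℝ) (τ : Strategy2) (v : ℝ) : Prop :=
  ∀ σ, IsStrategy1 σ → ∀ ε > 0, ∀ᶠ n in atTop, avgGain p q σ τ n ≤ v + ε

/-- `v` is the value of the game: Player 1 can guarantee every smaller number and Player 2 can
guarantee every larger one. -/
def IsValue (p q v : ℝ) : Prop :=
  (∀ w < v, ∃ σ, IsStrategy1 σ ∧ Guarantees1 p q σ w) ∧
    (∀ w > v, ∃ τ, IsStrategy2 τ ∧ Guarantees2 p q τ w)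

/-- `σ` is an optimal strategy of Player 1: it guarantees the value of the game. -/
def IsOptimal1 (p q : ℝ) (σ : Strategy1) : Prop :=
  IsStrategy1 σ ∧ ∃ v, IsValue p q v ∧ Guarantees1 p q σ v

/-- `τ` is an optimal strategy of Player 2: it guarantees the value of the game. -/
def IsOptimal2 (p q : ℝ) (τ : Strategy2) : Prop :=
  IsStrategy2 τ ∧ ∃ v, IsValue p q v ∧ Guarantees2 p q τ v

/-! ## The belief automaton and the strategy `σ*` -/

/-- The new internal state after Player 1 plays `B`. -/
noncomputable def fB (p θ : ℝ) : ℝ :=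
  if 1 / 2 ≤ θ then p * ((2 * θ - 1) / θ) + (1 - p) * ((1 - θ) / θ) else 1 - p

/-- The new internal state after Player 1 plays `T`. -/
noncomputable def fT (p θ : ℝ) : ℝ :=
  if 1 / 2 ≤ θ then p else p * (θ / (1 - θ)) + (1 - p) * ((1 - 2 * θ) / (1 - θ))

/-- The map `Φ`. -/
noncomputable def Phi (p θ : ℝ) : ℝ := if 1 / 2 ≤ θ then fB p θ else fT p θ

/-- The internal state after the given moves of Player 1 (most recent first), starting from `θ₀`. -/
noncomputable def belief (p θ₀ : ℝ) : List Act1 → ℝ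
  | [] => θ₀
  | .T :: l => fT p (belief p θ₀ l)
  | .B :: l => fB p (belief p θ₀ l)

/-- The probability with which `σ*` plays `T` in the internal state `θ`; the two cases of the
definition agree at `θ = 1/2`. -/
noncomputable def sigmaT (θ : ℝ) : Sys → ℝ
  | .lo => if θ ≤ 1 / 2 then 1 else (1 - θ) / θ
  | .hi => if θ ≤ 1 / 2 then (1 - 2 * θ) / (1 - θ) else 0

/-- The strategy `σ*` of Player 1, started in the internal state `θ₀`. -/
noncomputable def sigmaStar (p θ₀ : ℝ) : Strategy1 := fun h s =>
  sigmaT (belief p θ₀ (h.map fun e => e.2.1)) s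

/-- The strategy of Player 2 that runs the same automaton, started in the state `θ₀`, and plays `L`
with probability `x θ` in the state `θ`. -/
noncomputable def automatonStrategy (p θ₀ : ℝ) (x : ℝ → ℝ) : Strategy2 := fun h =>
  x (belief p θ₀ (h.map Prod.fst))

/-! ## The function `x(θ)` -/

/-- The constant `γ = 2p - 1`. -/
def gam (p : ℝ) : ℝ := 2 * p - 1

/-- The matrix `A₁` for `θ > 1/2` and `A₀` for `θ < 1/2`. For `θ = 1/2` it is
`(A₁ + A₀ J) / 2`, where `J` exchanges the coordinates: as `Φ(1/2) = 1 - p`, this choice encodes the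
equation `G(1/2) = H(1/2) = 1/2 - v - γ Z` (see `score_half`). -/
noncomputable def sideMat (p θ : ℝ) : Matrix (Fin 2) (Fin 2) ℝ :=
  if 1 / 2 < θ then !![p, 1 - p; -gam p, gam p]
  else if θ < 1 / 2 then !![gam p, -gam p; 1 - p, p]
  else !![(1 - p) / 2, p / 2; (1 - p) / 2, p / 2]

/-- The product of the first `n` side matrices along the `Φ`-orbit of `θ`. -/
noncomputable def sideProd (p : ℝ) : ℕ → ℝ → Matrix (Fin 2) (Fin 2) ℝ
  | 0, _ => 1
  | n + 1, θ => sideMat p θ * sideProd p n (Phi p θ)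

/-- The vector `(I + A_{η₀} + A_{η₀} A_{η₁} + ⋯) (1, 1)ᵀ` for the orbit of `θ`. -/
noncomputable def wVec (p θ : ℝ) : Fin 2 → ℝ :=
  ∑' n, (sideProd p n θ).mulVec (fun _ => 1)

/-- The number `v`. -/
noncomputable def vStar (p : ℝ) : ℝ := 1 / (p * wVec p p 0 + (1 - p) * wVec p p 1)

/-- The number `Z`. -/
noncomputable def ZStar (p : ℝ) : ℝ := (wVec p p 0 - wVec p p 1) * vStar p / 2

/-- The relative score `G(θ)` of the position `(s̲, θ)`. -/
noncomputable def scoreG (p θ : ℝ) : ℝ := 1 - gam p * ZStar p - vStar p * wVec p θ 0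

/-- The relative score `H(θ)` of the position `(s̄, θ)`. -/
noncomputable def scoreH (p θ : ℝ) : ℝ := 1 - gam p * ZStar p - vStar p * wVec p θ 1

/-- The probability `x(θ)` that Player 2 plays `L` in the state `θ`. -/
noncomputable def xStar (p θ : ℝ) : ℝ :=
  if 1 / 2 < θ then scoreG p θ + vStar p + gam p * ZStar p
  else if θ < 1 / 2 then 1 - (scoreH p θ + vStar p + gam p * ZStar p)
  else 1 / 2

/-! ## The defining equations of the scores

The series converge, and the scores satisfy the equations they are meant to solve. -/

theorem sideMat_contr {p : ℝ} (hp : p ∈ Icc (1 / 2 : ℝ) (3 / 4)) (θ : ℝ) (u : Fin 2 → ℝ) :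
    ((sideMat p θ).mulVec u 0) ^ 2 + ((sideMat p θ).mulVec u 1) ^ 2
      ≤ (19 / 20) ^ 2 * (u 0 ^ 2 + u 1 ^ 2) := by
  obtain ⟨h1, h2⟩ := hp
  obtain ⟨g, hg⟩ : ∃ g, g = 2 * p - 1 := ⟨_, rfl⟩
  have hp' : p = (1 + g) / 2 := by linarith
  have g0 : 0 ≤ g := by linarith
  have g1 : g ≤ 1 / 2 := by linarith
  have g2 : g ^ 2 ≤ 1 / 4 := by nlinarith
  unfold sideMat gam
  split_ifs <;>
    simp only [Matrix.mulVec, dotProduct, Fin.sum_univ_two, Matrix.of_apply, Matrix.cons_val',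
      Matrix.cons_val_zero, Matrix.cons_val_one, Matrix.cons_val_fin_one] <;>
    subst hp' <;>
    generalize u 0 = a <;> generalize u 1 = b
  · have h3 : g * (a + b) * (b - a) ≤ (1 / 4) * ((a + b) ^ 2 + (b - a) ^ 2) := by
      nlinarith [mul_nonneg g0 (sq_nonneg (a + b - (b - a))),
        mul_nonneg (sub_nonneg.2 g1) (add_nonneg (sq_nonneg (a + b)) (sq_nonneg (b - a)))]
    have h4 : g ^ 2 * (b - a) ^ 2 ≤ 1 / 4 * (b - a) ^ 2 :=
      mul_le_mul_of_nonneg_right g2 (sq_nonneg _)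
    nlinarith [sq_nonneg (a + b), sq_nonneg (b - a)]
  · have h3 : g * (a + b) * (b - a) ≤ (1 / 4) * ((a + b) ^ 2 + (b - a) ^ 2) := by
      nlinarith [mul_nonneg g0 (sq_nonneg (a + b - (b - a))),
        mul_nonneg (sub_nonneg.2 g1) (add_nonneg (sq_nonneg (a + b)) (sq_nonneg (b - a)))]
    have h4 : g ^ 2 * (b - a) ^ 2 ≤ 1 / 4 * (b - a) ^ 2 :=
      mul_le_mul_of_nonneg_right g2 (sq_nonneg _)
    nlinarith [sq_nonneg (a + b), sq_nonneg (b - a)]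
  · have h3 : g * (a + b) * (b - a) ≤ (1 / 4) * ((a + b) ^ 2 + (b - a) ^ 2) := by
      nlinarith [mul_nonneg g0 (sq_nonneg (a + b - (b - a))),
        mul_nonneg (sub_nonneg.2 g1) (add_nonneg (sq_nonneg (a + b)) (sq_nonneg (b - a)))]
    have h4 : g ^ 2 * (b - a) ^ 2 ≤ 1 / 4 * (b - a) ^ 2 :=
      mul_le_mul_of_nonneg_right g2 (sq_nonneg _)
    nlinarith [sq_nonneg (a + b), sq_nonneg (b - a)]

theorem sideProd_bound {p : ℝ} (hp : p ∈ Icc (1 / 2 : ℝ) (3 / 4)) (n : ℕ) : ∀ θ : ℝ,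
    ((sideProd p n θ).mulVec (fun _ => 1) 0) ^ 2 + ((sideProd p n θ).mulVec (fun _ => 1) 1) ^ 2
      ≤ ((19 / 20) ^ n) ^ 2 * 2 := by
  induction n with
  | zero => intro θ; norm_num [sideProd]
  | succ n ih =>
    intro θ
    rw [sideProd, ← Matrix.mulVec_mulVec]
    refine (sideMat_contr hp θ _).trans ?_
    calc _ ≤ (19 / 20 : ℝ) ^ 2 * (((19 / 20) ^ n) ^ 2 * 2) :=
          mul_le_mul_of_nonneg_left (ih _) (by norm_num)
      _ = _ := by ring

/-- The series that defines `wVec` converges. -/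
theorem summable_wVec {p : ℝ} (hp : p ∈ Icc (1 / 2 : ℝ) (3 / 4)) (θ : ℝ) :
    Summable fun n => (sideProd p n θ).mulVec (fun _ => (1 : ℝ)) := by
  rw [Pi.summable]
  intro i
  refine Summable.of_norm_bounded (g := fun n => (19 / 20 : ℝ) ^ n * 2)
    ((summable_geometric_of_lt_one (by norm_num) (by norm_num)).mul_right 2) fun n => ?_
  have h := sideProd_bound hp n θ
  have h0 : (0 : ℝ) ≤ (19 / 20 : ℝ) ^ n := by positivity
  rw [Real.norm_eq_abs]
  refine abs_le_of_sq_le_sq ?_ (by positivity)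
  fin_cases i <;> simp only [Fin.zero_eta, Fin.mk_one] <;>
    nlinarith [sq_nonneg ((sideProd p n θ).mulVec (fun _ => (1 : ℝ)) 0),
      sq_nonneg ((sideProd p n θ).mulVec (fun _ => (1 : ℝ)) 1), sq_nonneg ((19 / 20 : ℝ) ^ n)]

theorem wVec_step {p : ℝ} (hp : p ∈ Icc (1 / 2 : ℝ) (3 / 4)) (θ : ℝ) :
    wVec p θ = (fun _ => 1) + (sideMat p θ).mulVec (wVec p (Phi p θ)) := by
  rw [wVec, (summable_wVec hp θ).tsum_eq_zero_add]
  congr 1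
  · simp [sideProd]
  · have h := (summable_wVec hp (Phi p θ)).map_tsum
      (LinearMap.toContinuousLinearMap (Matrix.mulVecLin (sideMat p θ)))
      (LinearMap.toContinuousLinearMap (Matrix.mulVecLin (sideMat p θ))).continuous
    simp only [LinearMap.coe_toContinuousLinearMap', Matrix.mulVecLin_apply] at h
    rw [wVec, h]
    simp only [sideProd, Matrix.mulVec_mulVec]

theorem sideProd_symm (p : ℝ) (n : ℕ) : ∀ θ : ℝ,
    (sideProd p n (1 - θ)).mulVec (fun _ => 1) 0 = (sideProd p n θ).mulVec (fun _ => 1) 1 ∧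
    (sideProd p n (1 - θ)).mulVec (fun _ => 1) 1 = (sideProd p n θ).mulVec (fun _ => 1) 0 := by
  induction n with
  | zero => intro θ; simp [sideProd]
  | succ n ih =>
    intro θ
    rcases lt_trichotomy θ (1 / 2) with h | h | h
    · have hΦ : Phi p (1 - θ) = 1 - Phi p θ := by
        have h1 : (1 : ℝ) - θ ≠ 0 := by linarith
        simp only [Phi, fB, fT, if_pos (show (1 / 2 : ℝ) ≤ 1 - θ by linarith), if_neg (not_le.2 h)]
        field_simp
        ring
      obtain ⟨i0, i1⟩ := ih (Phi p θ)
      simp only [sideProd, ← Matrix.mulVec_mulVec, hΦ]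
      generalize (sideProd p n (1 - Phi p θ)).mulVec (fun _ => 1) = a at *
      generalize (sideProd p n (Phi p θ)).mulVec (fun _ => 1) = b at *
      simp only [sideMat, if_pos (show (1 / 2 : ℝ) < 1 - θ by linarith), if_pos h,
        if_neg (not_lt.2 h.le)]
      simp [Matrix.mulVec, dotProduct, Fin.sum_univ_two, i0, i1]
      constructor <;> ring
    · subst h
      simp only [sideProd, ← Matrix.mulVec_mulVec, show (1 : ℝ) - 1 / 2 = 1 / 2 by norm_num]
      simp [sideMat, Matrix.mulVec, dotProduct, Fin.sum_univ_two]
    · have hΦ : Phi p (1 - θ) = 1 - Phi p θ := by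
        have h1 : θ ≠ 0 := by linarith
        simp only [Phi, fB, fT, if_neg (show ¬ (1 / 2 : ℝ) ≤ 1 - θ by linarith), if_pos h.le,
          sub_sub_cancel]
        field_simp
        ring
      obtain ⟨i0, i1⟩ := ih (Phi p θ)
      simp only [sideProd, ← Matrix.mulVec_mulVec, hΦ]
      generalize (sideProd p n (1 - Phi p θ)).mulVec (fun _ => 1) = a at *
      generalize (sideProd p n (Phi p θ)).mulVec (fun _ => 1) = b at *
      simp only [sideMat, if_neg (show ¬ (1 / 2 : ℝ) < 1 - θ by linarith), if_pos h,
        if_pos (show 1 - θ < (1 / 2 : ℝ) by linarith)]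
      simp [Matrix.mulVec, dotProduct, Fin.sum_univ_two, i0, i1]
      constructor <;> ring

theorem wVec_apply {p : ℝ} (hp : p ∈ Icc (1 / 2 : ℝ) (3 / 4)) (θ : ℝ) (i : Fin 2) :
    wVec p θ i = ∑' n, (sideProd p n θ).mulVec (fun _ => 1) i := by
  rw [wVec, tsum_apply (summable_wVec hp θ)]

/-- The symmetry `G(1 - θ) = H(θ)`. -/
theorem score_symm {p : ℝ} (hp : p ∈ Icc (1 / 2 : ℝ) (3 / 4)) (θ : ℝ) :
    scoreG p (1 - θ) = scoreH p θ := by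
  simp only [scoreG, scoreH, wVec_apply hp, (sideProd_symm p _ θ).1]

/-- The equation for the scores at `θ > 1/2`. -/
theorem score_gt {p : ℝ} (hp : p ∈ Icc (1 / 2 : ℝ) (3 / 4)) {θ : ℝ} (h : 1 / 2 < θ) :
    scoreG p θ = p * scoreG p (Phi p θ) + (1 - p) * scoreH p (Phi p θ) - vStar p ∧
    scoreH p θ = -gam p * scoreG p (Phi p θ) + gam p * scoreH p (Phi p θ) - vStar p
      + (1 - gam p * ZStar p) := by
  simp only [scoreG, scoreH, wVec_step hp θ, sideMat, if_pos h]
  simp only [Matrix.mulVec, dotProduct, Fin.sum_univ_two, Matrix.of_apply, Matrix.cons_val',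
    Matrix.cons_val_zero, Matrix.cons_val_one, Matrix.cons_val_fin_one, Pi.add_apply]
  constructor <;> ring

/-- The equation for the scores at `θ < 1/2`. -/
theorem score_lt {p : ℝ} (hp : p ∈ Icc (1 / 2 : ℝ) (3 / 4)) {θ : ℝ} (h : θ < 1 / 2) :
    scoreG p θ = gam p * scoreG p (Phi p θ) - gam p * scoreH p (Phi p θ) - vStar p
      + (1 - gam p * ZStar p) ∧
    scoreH p θ = (1 - p) * scoreG p (Phi p θ) + p * scoreH p (Phi p θ) - vStar p := by
  simp only [scoreG, scoreH, wVec_step hp θ, sideMat, if_pos h, if_neg (not_lt.2 h.le)]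
  simp only [Matrix.mulVec, dotProduct, Fin.sum_univ_two, Matrix.of_apply, Matrix.cons_val',
    Matrix.cons_val_zero, Matrix.cons_val_one, Matrix.cons_val_fin_one, Pi.add_apply]
  constructor <;> ring

theorem sideProd_nonneg (p : ℝ) (n : ℕ) : ∀ θ : ℝ,
    0 ≤ θ * (sideProd p n θ).mulVec (fun _ => 1) 0
      + (1 - θ) * (sideProd p n θ).mulVec (fun _ => 1) 1 := by
  induction n with
  | zero => intro θ; simp [sideProd]
  | succ n ih =>
    intro θ
    have key := ih (Phi p θ)
    simp only [sideProd, ← Matrix.mulVec_mulVec]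
    generalize (sideProd p n (Phi p θ)).mulVec (fun _ => 1) = a at *
    rcases lt_trichotomy θ (1 / 2) with h | h | h
    · have h1 : (0 : ℝ) < 1 - θ := by linarith
      have hΦ : (1 - θ) * Phi p θ = p * θ + (1 - p) * (1 - 2 * θ) := by
        simp only [Phi, fT, if_neg (not_le.2 h)]
        field_simp
      simp only [sideMat, if_pos h, if_neg (not_lt.2 h.le)]
      simp [Matrix.mulVec, dotProduct, Fin.sum_univ_two, gam]
      have := mul_nonneg h1.le key
      linear_combination this + (a 0 - a 1) * hΦ
    · subst h
      have hΦ : Phi p (1 / 2) = 1 - p := by norm_num [Phi, fB]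
      rw [hΦ] at key
      simp only [sideMat, lt_irrefl, if_false]
      simp [Matrix.mulVec, dotProduct, Fin.sum_univ_two]
      linarith
    · have h1 : (0 : ℝ) < θ := by linarith
      have hΦ : θ * Phi p θ = p * (2 * θ - 1) + (1 - p) * (1 - θ) := by
        simp only [Phi, fB, if_pos h.le]
        field_simp
      simp only [sideMat, if_pos h]
      simp [Matrix.mulVec, dotProduct, Fin.sum_univ_two, gam]
      have := mul_nonneg h1.le key
      linear_combination this + (a 0 - a 1) * hΦ

/-- The denominator of `v` is positive. -/
theorem one_le_denom {p : ℝ} (hp : p ∈ Icc (1 / 2 : ℝ) (3 / 4)) :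
    1 ≤ p * wVec p p 0 + (1 - p) * wVec p p 1 := by
  have hs := Pi.summable.1 (summable_wVec hp p)
  have hsum : Summable fun n => p * (sideProd p n p).mulVec (fun _ => 1) 0
      + (1 - p) * (sideProd p n p).mulVec (fun _ => 1) 1 :=
    ((hs 0).mul_left p).add ((hs 1).mul_left (1 - p))
  have h := hsum.le_tsum 0 fun n _ => sideProd_nonneg p n p
  rw [((hs 0).mul_left p).tsum_add ((hs 1).mul_left (1 - p)), tsum_mul_left, tsum_mul_left,
    ← wVec_apply hp, ← wVec_apply hp] at h
  simpa [sideProd] using h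

/-- The normalization `G(p) = -Z`, `H(p) = Z`. -/
theorem score_base {p : ℝ} (hp : p ∈ Icc (1 / 2 : ℝ) (3 / 4)) :
    scoreG p p = -ZStar p ∧ scoreH p p = ZStar p := by
  have h0 : p * wVec p p 0 + (1 - p) * wVec p p 1 ≠ 0 := by linarith [one_le_denom hp]
  have hv : vStar p * (p * wVec p p 0 + (1 - p) * wVec p p 1) = 1 := by
    rw [vStar, one_div, inv_mul_cancel₀ h0]
  simp only [scoreG, scoreH, ZStar, gam]
  constructor <;> linear_combination -hv

/-- The equation for the scores at `θ = 1/2`. -/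
theorem score_half {p : ℝ} (hp : p ∈ Icc (1 / 2 : ℝ) (3 / 4)) :
    scoreG p (1 / 2) = 1 / 2 - vStar p - gam p * ZStar p ∧
    scoreH p (1 / 2) = 1 / 2 - vStar p - gam p * ZStar p := by
  obtain ⟨b0, b1⟩ := score_base hp
  have hΦ : Phi p (1 / 2) = 1 - p := by norm_num [Phi, fB]
  have e0 : wVec p (1 - p) 0 = wVec p p 1 := by
    simp only [wVec_apply hp, (sideProd_symm p _ p).1]
  have e1 : wVec p (1 - p) 1 = wVec p p 0 := by
    simp only [wVec_apply hp, (sideProd_symm p _ p).2]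
  simp only [scoreG, scoreH] at *
  simp only [wVec_step hp (1 / 2), hΦ, sideMat, lt_irrefl, if_false, Matrix.mulVec, dotProduct,
    Fin.sum_univ_two, Matrix.of_apply, Matrix.cons_val', Matrix.cons_val_zero, Matrix.cons_val_one,
    Matrix.cons_val_fin_one, Pi.add_apply, e0, e1]
  unfold gam at *
  constructor <;> linear_combination ((1 - p) / 2) * b1 + (p / 2) * b0

end AsymGame

/-!
Both players watch the belief automaton: its state `θ` is the probability of `lo` given the past
actions when Player 1 plays `σ*`.

Under `σ*` each stage pays `min θ (1 - θ)` whatever Player 2 does, and the average `wMean` of the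
vector `w` under the belief solves the corresponding Bellman equation. Hence `n v - v wMean p θ` is
a lower bound of the gain in `n` stages if the prior belief is the internal state. For other prior
beliefs note that some action of `σ*` reveals the state with positive probability, and that the
internal state is correct from then on.

For Player 2 the relative scores `(G, H)` serve as a potential: at `x(θ)` the gain of one stage plus
the expected new score exceeds the old score by at most `v`. By the symmetry `θ ↦ 1 - θ` one may
assume `1/2 ≤ θ`, and then this and `0 ≤ x(θ) ≤ 1` amount to inequalities on `wMean` and on the
difference `wDiff` of the entries of `w`. Both functions satisfy recursions along the orbit of `Φ`,
folded to `[1/2, p]`, and a few steps of these recursions contract any violation of the claimed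
bounds, so there is none.
-/

namespace AsymGame

variable {p θ x y e : ℝ}

/-! ## Expected gains -/

theorem mix_self (w a : ℝ) : mix w a a = a := by unfold mix; ring

theorem mix_add_const (w a b c : ℝ) : mix w (a + c) (b + c) = mix w a b + c := by unfold mix; ring

theorem mix_le_mix {w a b a' b' : ℝ} (hw : w ∈ Icc (0 : ℝ) 1) (ha : a ≤ a') (hb : b ≤ b') :
    mix w a b ≤ mix w a' b' :=
  add_le_add (mul_le_mul_of_nonneg_left ha hw.1)
    (mul_le_mul_of_nonneg_left hb (sub_nonneg.2 hw.2))

theorem mix_le {w a b c : ℝ} (hw : w ∈ Icc (0 : ℝ) 1) (ha : a ≤ c) (hb : b ≤ c) :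
    mix w a b ≤ c :=
  (mix_le_mix hw ha hb).trans_eq (mix_self w c)

theorem le_mix {w a b c : ℝ} (hw : w ∈ Icc (0 : ℝ) 1) (ha : c ≤ a) (hb : c ≤ b) :
    c ≤ mix w a b :=
  (mix_self w c).symm.trans_le (mix_le_mix hw ha hb)

/-- The expected total gain over the next `n + 1` stages when Player 1 plays `a` in the first of
them and follows `σ` afterwards. -/
noncomputable def expGainPlaying (p : ℝ) (σ : Strategy1) (τ : Strategy2) (n : ℕ)
    (h : List (Sys × Act1 × Act2)) (s : Sys) (a : Act1) : ℝ :=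
  let next : Act2 → ℝ := fun b => stageGain s a b +
    mix p (expGain p σ τ n ((s, a, b) :: h) s) (expGain p σ τ n ((s, a, b) :: h) s.flip)
  mix (τ (h.map Prod.snd)) (next .L) (next .R)

theorem expGain_succ (p : ℝ) (σ : Strategy1) (τ : Strategy2) (n : ℕ)
    (h : List (Sys × Act1 × Act2)) (s : Sys) :
    expGain p σ τ (n + 1) h s
      = mix (σ h s) (expGainPlaying p σ τ n h s .T) (expGainPlaying p σ τ n h s .B) :=
  rfl

theorem stageGain_nonneg : ∀ s a b, 0 ≤ stageGain s a b
  | .lo, .T, .L => zero_le_one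
  | .hi, .B, .R => zero_le_one
  | .lo, .T, .R => le_rfl
  | .lo, .B, .L => le_rfl
  | .lo, .B, .R => le_rfl
  | .hi, .T, .L => le_rfl
  | .hi, .T, .R => le_rfl
  | .hi, .B, .L => le_rfl

theorem le_expGainPlaying {σ : Strategy1} {τ : Strategy2} (hτ : IsStrategy2 τ) {n : ℕ}
    {h : List (Sys × Act1 × Act2)} {s : Sys} {a : Act1} {c : ℝ}
    (hc : ∀ b, c ≤ mix p (expGain p σ τ n ((s, a, b) :: h) s)
      (expGain p σ τ n ((s, a, b) :: h) s.flip)) :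
    c ≤ expGainPlaying p σ τ n h s a :=
  le_mix (hτ _) (le_add_of_nonneg_of_le (stageGain_nonneg s a .L) (hc .L))
    (le_add_of_nonneg_of_le (stageGain_nonneg s a .R) (hc .R))

theorem eventually_div_le (C : ℝ) {ε : ℝ} (hε : 0 < ε) : ∀ᶠ n : ℕ in atTop, 0 < n ∧ C / n ≤ ε :=
  (eventually_gt_atTop 0).and
    ((tendsto_const_div_atTop_nhds_zero_nat C).eventually (eventually_le_nhds hε))

theorem guarantees1_of_bound {q v C : ℝ} {σ : Strategy1} (hq : q ∈ Icc (0 : ℝ) 1)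
    (h : ∀ τ, IsStrategy2 τ → ∀ n s, n * v - C ≤ expGain p σ τ n [] s) :
    Guarantees1 p q σ v := by
  intro τ hτ ε hε
  filter_upwards [eventually_div_le C hε] with n ⟨hn, hCn⟩
  have hn0 : (n : ℝ) ≠ 0 := by exact_mod_cast hn.ne'
  calc v - ε ≤ v - C / n := by linarith
    _ = (n * v - C) / n := by field_simp
    _ ≤ avgGain p q σ τ n := by
        rw [avgGain]
        gcongr
        exact le_mix hq (h τ hτ n _) (h τ hτ n _)

theorem guarantees2_of_bound {q v C : ℝ} {τ : Strategy2} (hq : q ∈ Icc (0 : ℝ) 1)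
    (h : ∀ σ, IsStrategy1 σ → ∀ n s, expGain p σ τ n [] s ≤ n * v + C) :
    Guarantees2 p q τ v := by
  intro σ hσ ε hε
  filter_upwards [eventually_div_le C hε] with n ⟨hn, hCn⟩
  have hn0 : (n : ℝ) ≠ 0 := by exact_mod_cast hn.ne'
  calc avgGain p q σ τ n ≤ (n * v + C) / n := by
        rw [avgGain]
        gcongr
        exact mix_le hq (h σ hσ n _) (h σ hσ n _)
    _ = v + C / n := by field_simp
    _ ≤ v + ε := by linarith

theorem optimal_of_guarantees {q v : ℝ} {σ : Strategy1} {τ : Strategy2} (hσ : IsStrategy1 σ)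
    (hτ : IsStrategy2 τ) (h1 : Guarantees1 p q σ v) (h2 : Guarantees2 p q τ v) :
    IsOptimal1 p q σ ∧ IsOptimal2 p q τ := by
  have hv : IsValue p q v := by
    refine ⟨fun w hw => ⟨σ, hσ, fun τ' hτ' ε hε => ?_⟩, fun w hw => ⟨τ, hτ, fun σ' hσ' ε hε => ?_⟩⟩
    · filter_upwards [h1 τ' hτ' ε hε] with n hn
      linarith
    · filter_upwards [h2 σ' hσ' ε hε] with n hn
      linarith
  exact ⟨⟨hσ, v, hv, h1⟩, hτ, v, hv, h2⟩

/-! ## The belief automaton -/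

/-- The other action of Player 1. -/
def Act1.flip : Act1 → Act1
  | .T => .B
  | .B => .T

theorem fT_one_sub (p θ : ℝ) : fT p (1 - θ) = 1 - fB p θ := by
  rcases lt_trichotomy θ (1 / 2) with h | rfl | h
  · rw [fT, fB, if_pos (by linarith), if_neg (by linarith)]
    ring
  · norm_num [fT, fB]
  · have : θ ≠ 0 := by linarith
    rw [fT, fB, if_neg (by linarith), if_pos h.le, sub_sub_cancel]
    field_simp
    ring

theorem fB_one_sub (p θ : ℝ) : fB p (1 - θ) = 1 - fT p θ := by
  have h := fT_one_sub p (1 - θ)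
  rw [sub_sub_cancel] at h
  linarith

theorem belief_one_sub (p θ : ℝ) : ∀ a, belief p (1 - θ) [a.flip] = 1 - belief p θ [a]
  | .T => fB_one_sub p θ
  | .B => fT_one_sub p θ

theorem belief_cons (p θ : ℝ) (l : List Act1) :
    ∀ a, belief p θ (a :: l) = belief p (belief p θ l) [a]
  | .T => rfl
  | .B => rfl

theorem mul_fB (p : ℝ) (hθ : 0 < θ) :
    θ * fB p θ = p * (θ - min θ (1 - θ)) + (1 - p) * min θ (1 - θ) := by
  rcases lt_or_ge θ (1 / 2) with h | h
  · rw [fB, if_neg (not_le.2 h), min_eq_left (by linarith)]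
    ring
  · rw [fB, if_pos h, min_eq_right (by linarith)]
    field_simp
    ring

theorem mul_fT (p : ℝ) (hθ : θ < 1) :
    (1 - θ) * fT p θ = p * min θ (1 - θ) + (1 - p) * (1 - θ - min θ (1 - θ)) := by
  have h := mul_fB p (θ := 1 - θ) (by linarith)
  rw [fB_one_sub, sub_sub_cancel, min_comm] at h
  linarith

theorem fT_of_half_le (h : 1 / 2 ≤ θ) : fT p θ = p :=
  if_pos h

theorem fB_of_le_half (h : θ ≤ 1 / 2) : fB p θ = 1 - p := by
  have hT := fT_one_sub p θ
  rw [fT_of_half_le (by linarith)] at hT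
  linarith

theorem Phi_of_half_le (h : 1 / 2 ≤ θ) : Phi p θ = fB p θ :=
  if_pos h

theorem Phi_half (p : ℝ) : Phi p (1 / 2) = 1 - p := by
  rw [Phi_of_half_le le_rfl, fB_of_le_half le_rfl]

theorem mul_Phi (h : 1 / 2 ≤ θ) : θ * Phi p θ = (3 * p - 1) * θ - (2 * p - 1) := by
  rw [Phi_of_half_le h, mul_fB p (by linarith), min_eq_right (by linarith)]
  ring

theorem one_sub_mem (hθ : θ ∈ Icc (1 - p) p) : 1 - θ ∈ Icc (1 - p) p :=
  ⟨by linarith [hθ.2], by linarith [hθ.1]⟩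

theorem fB_mem (hp : p ∈ Icc (1 / 2 : ℝ) 1) (hθ : θ ∈ Icc (1 - p) p) : fB p θ ∈ Icc (1 - p) p := by
  obtain ⟨hp1, hp2⟩ := hp
  obtain ⟨hθ1, hθ2⟩ := hθ
  unfold fB
  split_ifs with h
  · have hθ0 : 0 < θ := by linarith
    rw [← mul_div_assoc, ← mul_div_assoc, ← add_div, mem_Icc, le_div_iff₀ hθ0, div_le_iff₀ hθ0]
    constructor <;> nlinarith
  · constructor <;> linarith

theorem fT_mem (hp : p ∈ Icc (1 / 2 : ℝ) 1) (hθ : θ ∈ Icc (1 - p) p) : fT p θ ∈ Icc (1 - p) p := by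
  have h := one_sub_mem (fB_mem hp (one_sub_mem hθ))
  rwa [fB_one_sub, sub_sub_cancel] at h

theorem belief_mem (hp : p ∈ Icc (1 / 2 : ℝ) 1) (hθ : θ ∈ Icc (1 - p) p) :
    ∀ l, belief p θ l ∈ Icc (1 - p) p
  | [] => hθ
  | .T :: l => fT_mem hp (belief_mem hp hθ l)
  | .B :: l => fB_mem hp (belief_mem hp hθ l)

/-- The internal state of the automaton started at `θ₀` after the history `h`. -/
noncomputable def internalState (p θ₀ : ℝ) (h : List (Sys × Act1 × Act2)) : ℝ :=
  belief p θ₀ (h.map fun e => e.2.1)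

theorem internalState_cons (p θ₀ : ℝ) (h : List (Sys × Act1 × Act2)) (s : Sys) (a : Act1)
    (b : Act2) : internalState p θ₀ ((s, a, b) :: h) = belief p (internalState p θ₀ h) [a] :=
  belief_cons p θ₀ _ a

theorem internalState_mem (hp : p ∈ Icc (1 / 2 : ℝ) 1) (hθ : θ ∈ Icc (1 - p) p)
    (h : List (Sys × Act1 × Act2)) : internalState p θ h ∈ Icc (1 - p) p :=
  belief_mem hp hθ _

theorem automatonStrategy_map_snd (p θ₀ : ℝ) (x : ℝ → ℝ) (h : List (Sys × Act1 × Act2)) :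
    automatonStrategy p θ₀ x (h.map Prod.snd) = x (internalState p θ₀ h) := by
  simp only [automatonStrategy, internalState, List.map_map, Function.comp_def]

theorem expGain_le_of_potential {θ₀ v C : ℝ} {x : ℝ → ℝ} {V : Sys → ℝ → ℝ}
    (hp : p ∈ Icc (1 / 2 : ℝ) 1) (hθ₀ : θ₀ ∈ Icc (1 - p) p)
    (hx : ∀ θ ∈ Icc (1 - p) p, x θ ∈ Icc (0 : ℝ) 1)
    (hV : ∀ θ ∈ Icc (1 - p) p, ∀ s a, mix (x θ) (stageGain s a .L) (stageGain s a .R)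
      + mix p (V s (belief p θ [a])) (V s.flip (belief p θ [a])) ≤ V s θ + v)
    (hC : ∀ θ ∈ Icc (1 - p) p, ∀ s, -C ≤ V s θ)
    {σ : Strategy1} (hσ : IsStrategy1 σ) (n : ℕ) : ∀ h s,
    expGain p σ (automatonStrategy p θ₀ x) n h s ≤ n * v + V s (internalState p θ₀ h) + C := by
  induction n with
  | zero =>
    intro h s
    have := hC _ (internalState_mem hp hθ₀ h) s
    simp only [expGain, Nat.cast_zero]
    linarith
  | succ n ih =>
    intro h s
    have hp01 : p ∈ Icc (0 : ℝ) 1 := ⟨by linarith [hp.1], hp.2⟩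
    have hmem := internalState_mem hp hθ₀ h
    set θ := internalState p θ₀ h
    have hcont : ∀ a b, mix p (expGain p σ (automatonStrategy p θ₀ x) n ((s, a, b) :: h) s)
        (expGain p σ (automatonStrategy p θ₀ x) n ((s, a, b) :: h) s.flip)
        ≤ mix p (V s (belief p θ [a])) (V s.flip (belief p θ [a])) + (n * v + C) := by
      intro a b
      rw [← mix_add_const]
      refine mix_le_mix hp01 ((ih _ _).trans_eq ?_) ((ih _ _).trans_eq ?_) <;>
        rw [internalState_cons] <;> ring
    have hplay : ∀ a, expGainPlaying p σ (automatonStrategy p θ₀ x) n h s a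
        ≤ (n + 1 : ℕ) * v + V s θ + C := by
      intro a
      rw [expGainPlaying, automatonStrategy_map_snd]
      refine (mix_le_mix (hx _ hmem) (add_le_add le_rfl (hcont a .L))
        (add_le_add le_rfl (hcont a .R))).trans ?_
      rw [mix_add_const]
      push_cast
      linarith [hV _ hmem s a]
    exact mix_le (hσ h s) (hplay .T) (hplay .B)

/-! ## The vector `w` -/

/-- The average `θ w₁(θ) + (1 - θ) w₂(θ)` of `w(θ)` under the belief `θ`. -/
noncomputable def wMean (p θ : ℝ) : ℝ := θ * wVec p θ 0 + (1 - θ) * wVec p θ 1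

/-- The difference `w₁(θ) - w₂(θ)`. -/
noncomputable def wDiff (p θ : ℝ) : ℝ := wVec p θ 0 - wVec p θ 1

section W

variable (hp : p ∈ Icc (1 / 2 : ℝ) (3 / 4))
include hp

theorem wVec_symm (θ : ℝ) : wVec p (1 - θ) 0 = wVec p θ 1 ∧ wVec p (1 - θ) 1 = wVec p θ 0 := by
  simp only [wVec_apply hp, (sideProd_symm p _ θ).1, (sideProd_symm p _ θ).2, and_self]

theorem wMean_symm (θ : ℝ) : wMean p (1 - θ) = wMean p θ := by
  rw [wMean, wMean, (wVec_symm hp θ).1, (wVec_symm hp θ).2]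
  ring

theorem wDiff_symm (θ : ℝ) : wDiff p (1 - θ) = -wDiff p θ := by
  rw [wDiff, wDiff, (wVec_symm hp θ).1, (wVec_symm hp θ).2]
  ring

theorem wDiff_half : wDiff p (1 / 2) = 0 := by
  have h := wDiff_symm hp (1 / 2)
  norm_num at h
  linarith

theorem wMean_nonneg (θ : ℝ) : 0 ≤ wMean p θ := by
  have hs := Pi.summable.1 (summable_wVec hp θ)
  rw [wMean, wVec_apply hp, wVec_apply hp, ← tsum_mul_left, ← tsum_mul_left,
    ← ((hs 0).mul_left θ).tsum_add ((hs 1).mul_left (1 - θ))]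
  exact tsum_nonneg fun n => sideProd_nonneg p n θ

theorem abs_sideProd_mulVec_one_le (n : ℕ) (θ : ℝ) (i : Fin 2) :
    |(sideProd p n θ).mulVec (fun _ => 1) i| ≤ (19 / 20) ^ n * 2 := by
  refine abs_le_of_sq_le_sq ?_ (by positivity)
  have hbound := sideProd_bound hp n θ
  have hsq : (sideProd p n θ).mulVec (fun _ => 1) i ^ 2 ≤ ((19 / 20) ^ n) ^ 2 * 2 := by
    fin_cases i
    · exact (le_add_of_nonneg_right (sq_nonneg _)).trans hbound
    · exact (le_add_of_nonneg_left (sq_nonneg _)).trans hbound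
  linarith [sq_nonneg ((19 / 20 : ℝ) ^ n), mul_pow ((19 / 20 : ℝ) ^ n) 2 2]

theorem abs_wVec_le (θ : ℝ) (i : Fin 2) : |wVec p θ i| ≤ 40 := by
  have hgeom := (hasSum_geometric_of_lt_one (r := (19 / 20 : ℝ)) (by norm_num)
    (by norm_num)).mul_right 2
  rw [show (1 - 19 / 20 : ℝ)⁻¹ * 2 = 40 by norm_num] at hgeom
  rw [wVec_apply hp, ← Real.norm_eq_abs]
  exact tsum_of_norm_bounded hgeom fun n => abs_sideProd_mulVec_one_le hp n θ i

theorem abs_wMean_le (hθ : θ ∈ Icc (0 : ℝ) 1) : |wMean p θ| ≤ 40 := by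
  have h0 := abs_le.1 (abs_wVec_le hp θ 0)
  have h1 := abs_le.1 (abs_wVec_le hp θ 1)
  exact abs_le.2 ⟨le_mix hθ h0.1 h1.1, mix_le hθ h0.2 h1.2⟩

theorem abs_wDiff_le (θ : ℝ) : |wDiff p θ| ≤ 80 := by
  have h := (abs_sub _ _).trans (add_le_add (abs_wVec_le hp θ 0) (abs_wVec_le hp θ 1))
  norm_num at h
  exact h

theorem wVec_of_gt (h : 1 / 2 < θ) :
    wVec p θ 0 = 1 + (wMean p (Phi p θ) + (p - Phi p θ) * wDiff p (Phi p θ)) ∧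
    wVec p θ 1 = 1 - gam p * wDiff p (Phi p θ) := by
  simp only [wVec_step hp θ, sideMat, if_pos h, wMean, wDiff, Matrix.mulVec, dotProduct,
    Fin.sum_univ_two, Matrix.of_apply, Matrix.cons_val', Matrix.cons_val_zero,
    Matrix.cons_val_one, Matrix.cons_val_fin_one, Pi.add_apply]
  constructor <;> ring

theorem wDiff_of_gt (h : 1 / 2 < θ) :
    wDiff p θ = wMean p (Phi p θ) + (3 * p - 1 - Phi p θ) * wDiff p (Phi p θ) := by
  rw [wDiff, (wVec_of_gt hp h).1, (wVec_of_gt hp h).2, gam]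
  ring

theorem wMean_half : wMean p (1 / 2) = 1 + 1 / 2 * wMean p p := by
  simp only [wMean, wVec_step hp (1 / 2), Phi_half, sideMat, lt_irrefl, if_false, Matrix.mulVec,
    dotProduct, Fin.sum_univ_two, Matrix.of_apply, Matrix.cons_val', Matrix.cons_val_zero,
    Matrix.cons_val_one, Matrix.cons_val_fin_one, Pi.add_apply, (wVec_symm hp p).1,
    (wVec_symm hp p).2]
  ring

theorem wMean_of_half_le (h : 1 / 2 ≤ θ) : wMean p θ = 1 + θ * wMean p (Phi p θ) := by
  rcases h.eq_or_lt with rfl | h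
  · rw [Phi_half, wMean_symm hp, wMean_half hp]
  · rw [wMean, (wVec_of_gt hp h).1, (wVec_of_gt hp h).2, gam]
    linear_combination -wDiff p (Phi p θ) * mul_Phi (p := p) h.le

/-- Under `σ*` Player 1 plays `T` with total probability `1 - θ` and wins `min θ (1 - θ)` against
every move of Player 2, so this is the Bellman equation of the average score, divided by `v`. -/
theorem wMean_eq (θ : ℝ) :
    wMean p θ = 1 + (1 - θ) * wMean p (fT p θ) + θ * wMean p (fB p θ)
      - min θ (1 - θ) * wMean p p := by
  have hupper : ∀ {η : ℝ}, 1 / 2 ≤ η → wMean p η = 1 + (1 - η) * wMean p (fT p η)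
      + η * wMean p (fB p η) - min η (1 - η) * wMean p p := by
    intro η h
    rw [min_eq_right (by linarith), fT_of_half_le h, ← Phi_of_half_le h, wMean_of_half_le hp h]
    ring
  rcases le_total (1 / 2) θ with h | h
  · exact hupper h
  · have h' := hupper (η := 1 - θ) (by linarith)
    rw [fT_one_sub, fB_one_sub, sub_sub_cancel, wMean_symm hp, wMean_symm hp, wMean_symm hp,
      min_comm] at h'
    linarith

theorem one_le_wMean_self : 1 ≤ wMean p p :=
  one_le_denom hp

theorem vStar_mul_wMean_self : vStar p * wMean p p = 1 :=
  one_div_mul_cancel (zero_lt_one.trans_le (one_le_wMean_self hp)).ne'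

theorem vStar_mem : vStar p ∈ Ioc (0 : ℝ) 1 :=
  have h := zero_lt_one.trans_le (one_le_wMean_self hp)
  ⟨one_div_pos.2 h, div_le_one_of_le₀ (one_le_wMean_self hp) h.le⟩

end W

/-! ## The strategy of Player 1 -/

theorem mul_sigmaT_lo (hθ : 0 < θ) : θ * sigmaT θ .lo = min θ (1 - θ) := by
  rw [sigmaT]
  split_ifs with h
  · rw [mul_one, min_eq_left (by linarith)]
  · rw [mul_div_cancel₀ _ hθ.ne', min_eq_right (by linarith)]

theorem mul_sigmaT_hi (hθ : θ < 1) : (1 - θ) * sigmaT θ .hi = 1 - θ - min θ (1 - θ) := by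
  rw [sigmaT]
  split_ifs with h
  · rw [mul_div_cancel₀ _ (by linarith), min_eq_left (by linarith)]
    ring
  · rw [min_eq_right (by linarith)]
    ring

theorem sigmaT_mem (h0 : 0 < θ) (h1 : θ < 1) : ∀ s, sigmaT θ s ∈ Icc (0 : ℝ) 1
  | .lo => by
    have h := mul_sigmaT_lo h0
    have hmin : 0 ≤ min θ (1 - θ) := le_min h0.le (by linarith)
    exact ⟨nonneg_of_mul_nonneg_right (h ▸ hmin) h0,
      le_of_mul_le_mul_left (by rw [h, mul_one]; exact min_le_left _ _) h0⟩
  | .hi => by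
    have h := mul_sigmaT_hi h1
    have hmin : min θ (1 - θ) ≤ 1 - θ := min_le_right _ _
    have hmin' : 0 ≤ min θ (1 - θ) := le_min h0.le (by linarith)
    exact ⟨nonneg_of_mul_nonneg_right (by rw [h]; linarith) (sub_pos.2 h1),
      le_of_mul_le_mul_left (by rw [h]; linarith) (sub_pos.2 h1)⟩

theorem isStrategy1_sigmaStar {θ₀ : ℝ} (hp : p ∈ Ico (1 / 2 : ℝ) 1) (hθ : θ₀ ∈ Icc (1 - p) p) :
    IsStrategy1 (sigmaStar p θ₀) := fun _ _ =>
  have hmem := belief_mem ⟨hp.1, hp.2.le⟩ hθ _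
  sigmaT_mem (by linarith [hmem.1, hp.2]) (by linarith [hmem.2, hp.2]) _

theorem expGain_sigmaStar_congr (p θ₀ : ℝ) (τ : Strategy2) (n : ℕ) : ∀ h h' s,
    h.map Prod.snd = h'.map Prod.snd →
    expGain p (sigmaStar p θ₀) τ n h s = expGain p (sigmaStar p θ₀) τ n h' s := by
  induction n with
  | zero => intros; rfl
  | succ n ih =>
    intro h h' s hmoves
    have hactions : (h.map fun e => e.2.1) = h'.map fun e => e.2.1 := by
      simpa only [List.map_map, Function.comp_def] using congrArg (List.map Prod.fst) hmoves
    have hcont : ∀ a b s', expGain p (sigmaStar p θ₀) τ n ((s, a, b) :: h) s'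
        = expGain p (sigmaStar p θ₀) τ n ((s, a, b) :: h') s' := fun a b s' =>
      ih _ _ _ (by rw [List.map_cons, List.map_cons, hmoves])
    simp only [expGain, sigmaStar, hmoves, hactions, hcont]

/-- If the pairs of state and action `(lo, a)` and `(hi, a)` have the probabilities `α` and `β`,
then `η` is the belief after `a`. -/
theorem le_expGainPlaying_sigmaStar {θ₀ α β η c : ℝ} {τ : Strategy2} (hτ : IsStrategy2 τ) {n : ℕ}
    {h : List (Sys × Act1 × Act2)} {a : Act1} (hαβ : 0 ≤ α + β)
    (hη : (α + β) * η = p * α + (1 - p) * β)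
    (hc : ∀ b, c ≤ mix η (expGain p (sigmaStar p θ₀) τ n ((.lo, a, b) :: h) .lo)
      (expGain p (sigmaStar p θ₀) τ n ((.lo, a, b) :: h) .hi)) :
    α * mix (τ (h.map Prod.snd)) (stageGain .lo a .L) (stageGain .lo a .R)
        + β * mix (τ (h.map Prod.snd)) (stageGain .hi a .L) (stageGain .hi a .R) + (α + β) * c
      ≤ α * expGainPlaying p (sigmaStar p θ₀) τ n h .lo a
        + β * expGainPlaying p (sigmaStar p θ₀) τ n h .hi a := by
  have hhi : ∀ b, expGain p (sigmaStar p θ₀) τ n ((.hi, a, b) :: h)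
      = expGain p (sigmaStar p θ₀) τ n ((.lo, a, b) :: h) := fun b =>
    funext fun s => expGain_sigmaStar_congr p θ₀ τ n _ _ s rfl
  have hy := hτ (h.map Prod.snd)
  have hL := mul_le_mul_of_nonneg_left (mul_le_mul_of_nonneg_left (hc .L) hαβ) hy.1
  have hR := mul_le_mul_of_nonneg_left (mul_le_mul_of_nonneg_left (hc .R) hαβ) (sub_nonneg.2 hy.2)
  simp only [expGainPlaying, Sys.flip, hhi]
  generalize τ (h.map Prod.snd) = y at *
  generalize expGain p (sigmaStar p θ₀) τ n ((.lo, a, .L) :: h) = EL at *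
  generalize expGain p (sigmaStar p θ₀) τ n ((.lo, a, .R) :: h) = ER at *
  simp only [mix] at *
  linear_combination hL + hR + (y * (EL .lo - EL .hi) + (1 - y) * (ER .lo - ER .hi)) * hη

theorem le_mix_expGain_sigmaStar {θ₀ : ℝ} (hp : p ∈ Icc (1 / 2 : ℝ) (3 / 4))
    (hθ₀ : θ₀ ∈ Icc (1 - p) p) {τ : Strategy2} (hτ : IsStrategy2 τ) (n : ℕ) : ∀ h,
    n * vStar p - vStar p * wMean p (internalState p θ₀ h) ≤ mix (internalState p θ₀ h)
      (expGain p (sigmaStar p θ₀) τ n h .lo) (expGain p (sigmaStar p θ₀) τ n h .hi) := by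
  induction n with
  | zero =>
    intro h
    have := mul_nonneg (vStar_mem hp).1.le (wMean_nonneg hp (internalState p θ₀ h))
    simp only [expGain, Nat.cast_zero, mix_self]
    linarith
  | succ n ih =>
    intro h
    have hmem := internalState_mem ⟨hp.1, by linarith [hp.2]⟩ hθ₀ h
    have hcont := fun a b => ih ((.lo, a, b) :: h)
    simp only [internalState_cons] at hcont
    have hstrat : ∀ s, sigmaStar p θ₀ h s = sigmaT (internalState p θ₀ h) s := fun s => rfl
    rw [expGain_succ, expGain_succ, hstrat, hstrat]
    generalize internalState p θ₀ h = θ at *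
    have h0 : 0 < θ := by linarith [hmem.1, hp.2]
    have h1 : θ < 1 := by linarith [hmem.2, hp.2]
    have hplayT := le_expGainPlaying_sigmaStar hτ (α := min θ (1 - θ))
      (β := 1 - θ - min θ (1 - θ)) (by linarith) (by rw [add_sub_cancel]; exact mul_fT p h1)
      (hcont .T)
    have hplayB := le_expGainPlaying_sigmaStar hτ (α := θ - min θ (1 - θ))
      (β := min θ (1 - θ)) (by linarith) (by rw [sub_add_cancel]; exact mul_fB p h0) (hcont .B)
    have hlo := mul_sigmaT_lo h0
    have hhi := mul_sigmaT_hi h1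
    simp only [mix, stageGain, belief] at hplayT hplayB ⊢
    push_cast
    linear_combination hplayT + hplayB - vStar p * wMean_eq hp θ
      + min θ (1 - θ) * vStar_mul_wMean_self hp
      - (expGainPlaying p (sigmaStar p θ₀) τ n h .lo .T
        - expGainPlaying p (sigmaStar p θ₀) τ n h .lo .B) * hlo
      - (expGainPlaying p (sigmaStar p θ₀) τ n h .hi .T
        - expGainPlaying p (sigmaStar p θ₀) τ n h .hi .B) * hhi

/-- The probability that `σ*` reveals the state, that is, plays the action that it never plays in
the other state: `T` if `θ > 1/2` and `B` if `θ ≤ 1/2`. -/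
noncomputable def revealProb (θ : ℝ) : Sys → ℝ
  | .lo => if θ ≤ 1 / 2 then 0 else (1 - θ) / θ
  | .hi => if θ ≤ 1 / 2 then θ / (1 - θ) else 0

theorem revealProb_mem (h0 : 0 < θ) (h1 : θ < 1) (s : Sys) : revealProb θ s ∈ Icc (0 : ℝ) 1 := by
  have h2 : 0 < 1 - θ := sub_pos.2 h1
  cases s <;> simp only [revealProb] <;> split_ifs with h
  · simp
  · exact ⟨by positivity, (div_le_one h0).2 (by linarith)⟩
  · exact ⟨by positivity, (div_le_one h2).2 (by linarith)⟩
  · simp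

theorem le_mix_revealProb (hp : p ∈ Icc (1 / 2 : ℝ) (3 / 4)) (hθ : θ ∈ Icc (1 - p) p) (s : Sys) :
    1 / 12 ≤ mix p (revealProb θ s) (revealProb θ s.flip) := by
  obtain ⟨hp1, hp2⟩ := hp
  obtain ⟨hθ1, hθ2⟩ := hθ
  rcases le_or_gt θ (1 / 2) with h | h
  · have hr : 1 / 3 ≤ θ / (1 - θ) := by
      rw [le_div_iff₀ (by linarith)]
      linarith
    cases s <;> simp only [revealProb, Sys.flip, mix, if_pos h] <;> nlinarith
  · have hr : 1 / 3 ≤ (1 - θ) / θ := by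
      rw [le_div_iff₀ (by linarith)]
      linarith
    cases s <;> simp only [revealProb, Sys.flip, mix, if_neg (not_le.2 h)] <;> nlinarith

theorem mix_revealProb_le (h0 : 0 < θ) (h1 : θ < 1) {s : Sys} {gT gB c r : ℝ} (hT : c ≤ gT)
    (hB : c ≤ gB) (hrT : 1 / 2 < θ → s = .lo → r ≤ gT) (hrB : θ ≤ 1 / 2 → s = .hi → r ≤ gB) :
    mix (revealProb θ s) r c ≤ mix (sigmaT θ s) gT gB := by
  have hσ := sigmaT_mem h0 h1 s
  rcases le_or_gt θ (1 / 2) with h | h <;> cases s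
  · have hr : revealProb θ .lo = 0 := if_pos h
    rw [hr, mix, zero_mul, zero_add, sub_zero, one_mul]
    exact le_mix hσ hT hB
  · have h2 : 1 - θ ≠ 0 := by linarith
    have hr : revealProb θ .hi = 1 - sigmaT θ .hi := by
      simp only [revealProb, sigmaT, if_pos h]
      field_simp
      ring
    calc mix (revealProb θ .hi) r c = mix (sigmaT θ .hi) c r := by rw [hr, mix, mix]; ring
      _ ≤ mix (sigmaT θ .hi) gT gB := mix_le_mix hσ hT (hrB h rfl)
  · have hr : revealProb θ .lo = sigmaT θ .lo := by
      simp only [revealProb, sigmaT, if_neg (not_le.2 h)]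
    rw [hr]
    exact mix_le_mix hσ (hrT h rfl) hB
  · have hr : revealProb θ .hi = 0 := if_neg (not_le.2 h)
    rw [hr, mix, zero_mul, zero_add, sub_zero, one_mul]
    exact le_mix hσ hT hB

/-- After a revealing action the internal state is the true belief, whatever it was before. -/
theorem mix_revealProb_le_expGain_succ {θ₀ c : ℝ} (hp : p ∈ Icc (1 / 2 : ℝ) (3 / 4))
    (hθ₀ : θ₀ ∈ Icc (1 - p) p) {τ : Strategy2} (hτ : IsStrategy2 τ) {n : ℕ}
    {h : List (Sys × Act1 × Act2)} {s : Sys}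
    (hc : ∀ a b, c ≤ mix p (expGain p (sigmaStar p θ₀) τ n ((s, a, b) :: h) s)
      (expGain p (sigmaStar p θ₀) τ n ((s, a, b) :: h) s.flip)) :
    mix (revealProb (internalState p θ₀ h) s) (n * vStar p - 1) c
      ≤ expGain p (sigmaStar p θ₀) τ (n + 1) h s := by
  have hmem := internalState_mem ⟨hp.1, by linarith [hp.2]⟩ hθ₀ h
  have hcont := fun a b => le_mix_expGain_sigmaStar hp hθ₀ hτ n ((s, a, b) :: h)
  have hv := vStar_mul_wMean_self hp
  simp only [internalState_cons] at hcont
  rw [expGain_succ, show sigmaStar p θ₀ h s = sigmaT (internalState p θ₀ h) s from rfl]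
  refine mix_revealProb_le (by linarith [hmem.1, hp.2]) (by linarith [hmem.2, hp.2])
    (le_expGainPlaying hτ (hc .T)) (le_expGainPlaying hτ (hc .B)) ?_ ?_
  · rintro hθ rfl
    refine le_expGainPlaying hτ fun b => ?_
    have hreset : belief p (internalState p θ₀ h) [.T] = p := fT_of_half_le hθ.le
    have := hcont .T b
    rwa [hreset, hv] at this
  · rintro hθ rfl
    refine le_expGainPlaying hτ fun b => ?_
    have hreset : belief p (internalState p θ₀ h) [.B] = 1 - p := fB_of_le_half hθ
    have := hcont .B b
    rw [hreset, wMean_symm hp, hv] at this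
    simp only [mix, Sys.flip] at this ⊢
    linarith

/-- The term `12 * revealProb` is needed for the induction: the probability of a revelation may
vanish in one stage, but then it is at least `1/12` on average in the next one. -/
theorem le_expGain_sigmaStar {θ₀ : ℝ} (hp : p ∈ Icc (1 / 2 : ℝ) (3 / 4))
    (hθ₀ : θ₀ ∈ Icc (1 - p) p) {τ : Strategy2} (hτ : IsStrategy2 τ) (n : ℕ) : ∀ h s,
    n * vStar p - 18 + 12 * revealProb (internalState p θ₀ h) s
      ≤ expGain p (sigmaStar p θ₀) τ n h s := by
  have hp1 : p ∈ Icc (1 / 2 : ℝ) 1 := ⟨hp.1, by linarith [hp.2]⟩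
  have hreveal : ∀ h s, revealProb (internalState p θ₀ h) s ∈ Icc (0 : ℝ) 1 := fun h s =>
    have hmem := internalState_mem hp1 hθ₀ h
    revealProb_mem (by linarith [hmem.1, hp.2]) (by linarith [hmem.2, hp.2]) s
  induction n with
  | zero =>
    intro h s
    simp only [expGain, Nat.cast_zero]
    linarith [(hreveal h s).2]
  | succ n ih =>
    intro h s
    have hcont : ∀ a b, n * vStar p - 17 ≤ mix p
        (expGain p (sigmaStar p θ₀) τ n ((s, a, b) :: h) s)
        (expGain p (sigmaStar p θ₀) τ n ((s, a, b) :: h) s.flip) := by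
      intro a b
      have hmem := internalState_mem hp1 hθ₀ ((s, a, b) :: h)
      refine le_trans ?_ (mix_le_mix ⟨by linarith [hp.1], hp1.2⟩ (ih _ _) (ih _ _))
      have := le_mix_revealProb hp hmem s
      simp only [mix] at this ⊢
      linarith
    refine le_trans ?_ (mix_revealProb_le_expGain_succ hp hθ₀ hτ hcont)
    push_cast
    rw [mix]
    linarith [(vStar_mem hp).2, (hreveal h s).1]

theorem guarantees1_sigmaStar {q θ₀ : ℝ} (hp : p ∈ Icc (1 / 2 : ℝ) (3 / 4))
    (hq : q ∈ Icc (0 : ℝ) 1) (hθ₀ : θ₀ ∈ Icc (1 - p) p) :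
    Guarantees1 p q (sigmaStar p θ₀) (vStar p) := by
  refine guarantees1_of_bound (C := 18) hq fun τ hτ n s => ?_
  have hmem := internalState_mem ⟨hp.1, by linarith [hp.2]⟩ hθ₀ []
  have hreveal := revealProb_mem (θ := internalState p θ₀ []) (by linarith [hmem.1, hp.2])
    (by linarith [hmem.2, hp.2]) s
  linarith [le_expGain_sigmaStar hp hθ₀ hτ n [] s, hreveal.1]

/-! ## Constants bounding `wMean` and `wDiff` -/

/-- A lower bound of `wMean p` on `[1/2, p]`. As `wMean p θ = 1 + θ + θ θ' wMean p θ''` along the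
folded orbit of `θ`, it solves `L = 1 + θ + θ θ' L` at `θ = 1/2`, where `θ' = p`. -/
noncomputable def meanLower (p : ℝ) : ℝ := 3 / (2 - p)

/-- An upper bound of `wMean p` on `[1/2, p]`. It solves the same equation as `meanLower p`, but at
`θ = p`. -/
noncomputable def meanUpper (p : ℝ) : ℝ := (1 + p) / (3 * p * (1 - p))

/-- An upper bound `D` of `wDiff p` on `[1/2, p]`. It is the largest number with
`2 γ D ≤ 1 + p L`, where `L = meanLower p` and thus `1 + p L ≤ wMean p p`. -/
noncomputable def diffUpper (p : ℝ) : ℝ := (1 + p) / ((2 - p) * (2 * p - 1))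

section Constants

variable (hp : p ∈ Icc (2 / 3 : ℝ) (18 / 25))
include hp

theorem meanLower_mul : meanLower p * (2 - p) = 3 :=
  div_mul_cancel₀ _ (by linarith [hp.2])

theorem meanUpper_mul : meanUpper p * (3 * p * (1 - p)) = 1 + p :=
  div_mul_cancel₀ _ (mul_pos (by linarith [hp.1]) (by linarith [hp.2])).ne'

theorem meanLower_mem : meanLower p ∈ Icc (9 / 4 : ℝ) (12 / 5) := by
  obtain ⟨h, h'⟩ := hp
  rw [meanLower, mem_Icc, le_div_iff₀ (by linarith), div_le_iff₀ (by linarith)]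
  constructor <;> linarith

theorem meanUpper_mem : meanUpper p ∈ Icc (5 / 2 : ℝ) (57 / 20) := by
  obtain ⟨h, h'⟩ := hp
  have : 0 < 3 * p * (1 - p) := mul_pos (by linarith) (by linarith)
  rw [meanUpper, mem_Icc, le_div_iff₀ this, div_le_iff₀ this]
  constructor <;> nlinarith

theorem le_diffUpper : 61 / 20 ≤ diffUpper p := by
  obtain ⟨h, h'⟩ := hp
  rw [diffUpper, le_div_iff₀ (mul_pos (by linarith) (by linarith))]
  nlinarith

theorem two_mul_diffUpper : 2 * ((2 * p - 1) * diffUpper p) = 1 + p * meanLower p := by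
  have h1 : 2 - p ≠ 0 := by linarith [hp.2]
  have h2 : 2 * p - 1 ≠ 0 := by linarith [hp.1]
  rw [meanLower, diffUpper]
  field_simp
  ring

theorem diffUpper_mul_le : (2 * p - 1) * diffUpper p ≤ meanLower p := by
  have h := two_mul_diffUpper hp
  have hL := meanLower_mul hp
  linarith [hp.2, (meanLower_mem hp).1]

theorem one_sub_mul_meanLower : 1 - (3 * p - 2) * meanLower p = 2 * (4 - 5 * p) / (2 - p) := by
  rw [eq_div_iff (by linarith [hp.2])]
  linear_combination -(3 * p - 2) * meanLower_mul hp

theorem one_sub_mul_meanLower_nonneg : 0 ≤ 1 - (3 * p - 2) * meanLower p := by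
  rw [one_sub_mul_meanLower hp]
  exact div_nonneg (by linarith [hp.2]) (by linarith [hp.2])

theorem one_add_mul_meanUpper : 1 + 3 * p / 4 * meanUpper p = (5 - 3 * p) / (4 * (1 - p)) := by
  rw [eq_div_iff (by linarith [hp.2])]
  linear_combination meanUpper_mul hp

theorem mean_bound_le : 5 / 3 + meanUpper p / 3 ≤ 1 + p * meanLower p := by
  have h2 : 0 < 1 - p := by linarith [hp.2]
  have h3 : 0 < 2 - p := by linarith
  have h0 : 0 < p := by linarith [hp.1]
  have hdiff : 1 + p * meanLower p - (5 / 3 + meanUpper p / 3)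
      = (3 * p - 2) * (1 + 8 * p - 11 * p ^ 2) / (9 * p * (1 - p) * (2 - p)) := by
    rw [meanLower, meanUpper]
    field_simp
    ring
  have hquad : 0 ≤ 1 + 8 * p - 11 * p ^ 2 := by nlinarith [hp.1, hp.2]
  have hnum : 0 ≤ (3 * p - 2) * (1 + 8 * p - 11 * p ^ 2) := mul_nonneg (by linarith [hp.1]) hquad
  rw [← sub_nonneg, hdiff]
  positivity

theorem cube_mul_le : (2 * p - 1) ^ 3 / p * (1 - (3 * p - 2) * meanLower p) ≤ 1 / 13 := by
  obtain ⟨h, h'⟩ := hp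
  have h0 : 0 < p := by linarith
  have h2 : 0 < 2 - p := by linarith
  have hnum : (2 * p - 1) ^ 3 * (4 - 5 * p) ≤ 4 / 117 := by
    -- the left side is largest at `2 * p - 1 = 9 / 20`
    nlinarith [mul_nonneg (sq_nonneg (2 * p - 1 - 9 / 20))
      (show 0 ≤ 5 / 2 * (2 * p - 1) ^ 2 + 3 / 4 * (2 * p - 1) + 27 / 160 by nlinarith)]
  have hden : 8 / 9 ≤ p * (2 - p) := by nlinarith
  rw [one_sub_mul_meanLower ⟨h, h'⟩, div_mul_div_comm, div_le_iff₀ (by positivity)]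
  linarith

theorem diff_bound_of_ge :
    1 + (3 * p - 1) + (2 * p - 1 - (3 * p - 1) * (3 * p - 2)) * (5 / 3 + meanUpper p / 3)
      ≤ diffUpper p := by
  have hU := (meanUpper_mem hp).2
  have hD := le_diffUpper hp
  obtain ⟨h, h'⟩ := hp
  have hcoef : 0 ≤ 2 * p - 1 - (3 * p - 1) * (3 * p - 2) := by nlinarith
  have hmean := mul_le_mul_of_nonneg_left
    (show 5 / 3 + meanUpper p / 3 ≤ 157 / 60 by linarith) hcoef
  nlinarith

theorem diff_bound_of_lt :
    1 + (3 * p - 1) + (2 * p - 1 - (3 * p - 1) * (3 * p - 2)) * (1 + 3 * p / 4 * meanUpper p)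
      + (2 * (3 * p - 1) - 1) * (2 * p - 1) ^ 2 / p * (1 - (3 * p - 2) * meanLower p)
      ≤ diffUpper p := by
  have hD := le_diffUpper hp
  have hcube := cube_mul_le hp
  have hmean : 1 + 3 * p / 4 * meanUpper p ≤ 9 / 4 + 134 / 25 * (p - 2 / 3) := by
    rw [one_add_mul_meanUpper hp, div_le_iff₀ (by linarith [hp.2])]
    nlinarith [hp.1, hp.2]
  have hcoef : 0 ≤ 2 * p - 1 - (3 * p - 1) * (3 * p - 2) := by nlinarith [hp.1, hp.2]
  have hpoly : 3 * p + (2 * p - 1 - (3 * p - 1) * (3 * p - 2)) * (9 / 4 + 134 / 25 * (p - 2 / 3))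
      ≤ 563 / 200 := by
    nlinarith [pow_nonneg (sub_nonneg.2 hp.1) 3, sq_nonneg (p - 2 / 3 - 1 / 20)]
  have hcube_eq : (2 * (3 * p - 1) - 1) * (2 * p - 1) ^ 2 / p = 3 * ((2 * p - 1) ^ 3 / p) := by
    ring
  rw [hcube_eq]
  linarith [mul_le_mul_of_nonneg_left hmean hcoef]

theorem prob_bound_of_ge :
    1 + p + (2 * p - 1 - p * (3 * p - 2)) * (5 / 3 + meanUpper p / 3) ≤ 1 + p * meanLower p := by
  have h2 : 0 < 1 - p := by linarith [hp.2]
  have h3 : 0 < 2 - p := by linarith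
  have h0 : 0 < p := by linarith [hp.1]
  have hdiff : 1 + p * meanLower p
      - (1 + p + (2 * p - 1 - p * (3 * p - 2)) * (5 / 3 + meanUpper p / 3))
      = (3 * p - 2) * (44 * p ^ 2 - 15 * p ^ 3 - 14 * p - 1) / (9 * p * (2 - p)) := by
    rw [meanLower, meanUpper]
    field_simp
    ring
  have hcubic : 0 ≤ 44 * p ^ 2 - 15 * p ^ 3 - 14 * p - 1 := by nlinarith [hp.1, hp.2]
  have hnum : 0 ≤ (3 * p - 2) * (44 * p ^ 2 - 15 * p ^ 3 - 14 * p - 1) :=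
    mul_nonneg (by linarith [hp.1]) hcubic
  rw [← sub_nonneg, hdiff]
  positivity

theorem prob_bound_of_lt :
    1 + p + (2 * p - 1 - p * (3 * p - 2)) * (1 + 3 * p / 4 * meanUpper p)
      + (2 * p - 1) * (2 * p - 1) ^ 2 / p * (1 - (3 * p - 2) * meanLower p)
      ≤ 1 + p * meanLower p := by
  have hcube := cube_mul_le hp
  have hmean : (2 * p - 1 - p * (3 * p - 2)) * (1 + 3 * p / 4 * meanUpper p)
      = (3 * p - 1) * (5 - 3 * p) / 4 := by
    linear_combination (3 * p - 1) / 4 * meanUpper_mul hp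
  have hlower : p + (3 * p - 1) * (5 - 3 * p) / 4 + 1 / 13 ≤ p * meanLower p := by
    rw [meanLower, mul_div_assoc', le_div_iff₀ (by linarith [hp.2])]
    nlinarith [hp.1, mul_nonneg (sq_nonneg (p - 2 / 3)) (show 0 ≤ 5 / 3 - p by linarith [hp.2])]
  have hcube_eq : (2 * p - 1) * (2 * p - 1) ^ 2 / p = (2 * p - 1) ^ 3 / p := by ring
  rw [hmean, hcube_eq]
  linarith

end Constants

/-! ## The folded orbit -/

/-- The map induced by `Φ` on `[1/2, p]` when `θ` and `1 - θ` are identified, which is possible as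
`wMean p` is even and `wDiff p` is odd under `θ ↦ 1 - θ`. -/
noncomputable def foldedPhi (p θ : ℝ) : ℝ := max (Phi p θ) (1 - Phi p θ)

theorem nonpos_of_contracting {α : Type*} {S : Set α} {f : α → ℝ} {c B : ℝ} (hc : c < 1)
    (hB : ∀ x ∈ S, f x ≤ B) (h : ∀ e ≥ 0, (∀ x ∈ S, f x ≤ e) → ∀ x ∈ S, f x ≤ c * e) :
    ∀ x ∈ S, f x ≤ 0 := by
  have hbdd : BddAbove (f '' S) := ⟨B, forall_mem_image.2 hB⟩
  have hle : ∀ x ∈ S, f x ≤ max 0 (sSup (f '' S)) := fun x hx =>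
    (le_csSup hbdd (mem_image_of_mem f hx)).trans (le_max_right _ _)
  intro x hx
  by_contra! hpos
  have hsup : 0 < sSup (f '' S) := hpos.trans_le (le_csSup hbdd (mem_image_of_mem f hx))
  have hstep := h _ (le_max_left _ _) hle
  rw [max_eq_right hsup.le] at hstep
  have : sSup (f '' S) ≤ c * sSup (f '' S) :=
    csSup_le ⟨_, mem_image_of_mem f hx⟩ (forall_mem_image.2 hstep)
  nlinarith

theorem half_le_foldedPhi (p x : ℝ) : 1 / 2 ≤ foldedPhi p x := by
  rcases le_total (Phi p x) (1 / 2) with h | h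
  · exact le_max_of_le_right (by linarith)
  · exact le_max_of_le_left h

theorem wMean_foldedPhi (hp : p ∈ Icc (1 / 2 : ℝ) (3 / 4)) (h : 1 / 2 ≤ x) :
    wMean p x = 1 + x * wMean p (foldedPhi p x) := by
  rw [wMean_of_half_le hp h, foldedPhi]
  rcases max_choice (Phi p x) (1 - Phi p x) with h | h <;> rw [h]
  rw [wMean_symm hp]

theorem wMean_foldedPhi_foldedPhi (hp : p ∈ Icc (1 / 2 : ℝ) (3 / 4)) (h : 1 / 2 ≤ x) :
    wMean p x = 1 + x + x * foldedPhi p x * wMean p (foldedPhi p (foldedPhi p x)) := by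
  rw [wMean_foldedPhi hp h, wMean_foldedPhi hp (half_le_foldedPhi p x)]
  ring

section Orbit

variable (hp : p ∈ Icc (2 / 3 : ℝ) (18 / 25))
include hp

theorem mem_Icc_half : p ∈ Icc (1 / 2 : ℝ) (3 / 4) :=
  ⟨by linarith [hp.1], by linarith [hp.2]⟩

theorem mem_Icc_one : p ∈ Icc (1 / 2 : ℝ) 1 :=
  ⟨by linarith [hp.1], by linarith [hp.2]⟩

theorem foldedPhi_of_lt (h : 1 / 2 ≤ x) (h' : x < 2 / 3) : foldedPhi p x = 1 - Phi p x := by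
  have := mul_Phi (p := p) h
  refine max_eq_right ?_
  nlinarith [hp.1, hp.2]

theorem foldedPhi_of_ge (h : 2 / 3 ≤ x) : foldedPhi p x = Phi p x := by
  have := mul_Phi (p := p) (show 1 / 2 ≤ x by linarith)
  refine max_eq_left ?_
  nlinarith [hp.1, hp.2]

theorem mul_foldedPhi_of_lt (h : 1 / 2 ≤ x) (h' : x < 2 / 3) :
    x * foldedPhi p x = 2 * p - 1 - (3 * p - 2) * x := by
  rw [foldedPhi_of_lt hp h h']
  linear_combination -mul_Phi (p := p) h

theorem mul_foldedPhi_of_ge (h : 2 / 3 ≤ x) :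
    x * foldedPhi p x = (3 * p - 1) * x - (2 * p - 1) := by
  rw [foldedPhi_of_ge hp h, mul_Phi (by linarith)]

theorem wDiff_of_lt (h : 1 / 2 < x) (h' : x < 2 / 3) :
    wDiff p x = wMean p (foldedPhi p x)
      - (foldedPhi p x + (3 * p - 2)) * wDiff p (foldedPhi p x) := by
  rw [wDiff_of_gt (mem_Icc_half hp) h, foldedPhi_of_lt hp h.le h', wMean_symm (mem_Icc_half hp),
    wDiff_symm (mem_Icc_half hp)]
  ring

theorem wDiff_of_ge (h : 2 / 3 ≤ x) :
    wDiff p x = wMean p (foldedPhi p x)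
      + (3 * p - 1 - foldedPhi p x) * wDiff p (foldedPhi p x) := by
  rw [wDiff_of_gt (mem_Icc_half hp) (by linarith), foldedPhi_of_ge hp h]

theorem foldedPhi_mem (hx : x ∈ Icc (1 / 2) p) : foldedPhi p x ∈ Icc (1 / 2) p := by
  refine ⟨half_le_foldedPhi p x, le_of_mul_le_mul_left ?_ (show 0 < x by linarith [hx.1])⟩
  rcases lt_or_ge x (2 / 3) with h | h
  · rw [mul_foldedPhi_of_lt hp hx.1 h]
    nlinarith [hx.1, hp.1]
  · rw [mul_foldedPhi_of_ge hp h]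
    nlinarith [hx.2, hp.1, hp.2]

theorem foldedPhi_lt (hx : x ∈ Icc (2 / 3) p) : foldedPhi p x < 2 / 3 := by
  have hx0 : 0 < x := by linarith [hx.1]
  refine lt_of_mul_lt_mul_left ?_ hx0.le
  rw [mul_foldedPhi_of_ge hp hx.1]
  nlinarith [hx.2, hp.1, hp.2]

theorem mul_foldedPhi_mem (hx : x ∈ Icc (1 / 2) p) : x * foldedPhi p x ∈ Icc (0 : ℝ) (1 / 2) := by
  refine ⟨mul_nonneg (by linarith [hx.1]) (by linarith [half_le_foldedPhi p x]), ?_⟩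
  rcases lt_or_ge x (2 / 3) with h | h
  · rw [mul_foldedPhi_of_lt hp hx.1 h]
    nlinarith [hx.1, hp.1, hp.2]
  · rw [mul_foldedPhi_of_ge hp h]
    nlinarith [hx.2, hp.1, hp.2]

/-! ## Bounds of `wMean` -/

theorem meanLower_le_step (hx : x ∈ Icc (1 / 2) p) :
    meanLower p ≤ 1 + x + x * foldedPhi p x * meanLower p := by
  have hL := meanLower_mem hp
  rcases lt_or_ge x (2 / 3) with h | h
  · rw [mul_foldedPhi_of_lt hp hx.1 h]
    linear_combination mul_nonneg (sub_nonneg.2 hx.1) (one_sub_mul_meanLower_nonneg hp)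
      + meanLower_mul hp / 2
  · rw [mul_foldedPhi_of_ge hp h]
    have hslope : 0 ≤ 1 + (3 * p - 1) * meanLower p := by nlinarith [hp.1, hL.1]
    linarith [mul_nonneg (sub_nonneg.2 h) hslope, hL.2]

theorem step_le_of_lt (hx : 1 / 2 ≤ x) (h : x < 2 / 3) :
    1 + x + x * foldedPhi p x * meanUpper p ≤ 5 / 3 + meanUpper p / 3 := by
  have hU := meanUpper_mem hp
  have hslope : 0 ≤ 1 - (3 * p - 2) * meanUpper p := by nlinarith [hp.1, hp.2, hU.1, hU.2]
  rw [mul_foldedPhi_of_lt hp hx h]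
  linear_combination mul_nonneg (sub_nonneg.2 h.le) hslope

theorem step_le_meanUpper (hx : x ∈ Icc (1 / 2) p) :
    1 + x + x * foldedPhi p x * meanUpper p ≤ meanUpper p := by
  have hU := meanUpper_mem hp
  rcases lt_or_ge x (2 / 3) with h | h
  · linarith [step_le_of_lt hp hx.1 h, hU.1]
  · have hslope : 0 ≤ 1 + (3 * p - 1) * meanUpper p := by nlinarith [hp.1, hU.1]
    rw [mul_foldedPhi_of_ge hp h]
    linear_combination mul_nonneg (sub_nonneg.2 hx.2) hslope - meanUpper_mul hp

theorem abs_wMean_le_of_mem (hx : x ∈ Icc (1 / 2) p) : |wMean p x| ≤ 40 :=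
  abs_wMean_le (mem_Icc_half hp) ⟨by linarith [hx.1], by linarith [hx.2, hp.2]⟩

theorem meanLower_le_wMean (hx : x ∈ Icc (1 / 2) p) : meanLower p ≤ wMean p x := by
  have hL := meanLower_mem hp
  suffices h : ∀ x ∈ Icc (1 / 2) p, meanLower p - wMean p x ≤ 0 from sub_nonpos.1 (h x hx)
  refine nonpos_of_contracting (c := 1 / 2) (B := 43) (by norm_num)
    (fun x hx => by linarith [(abs_le.1 (abs_wMean_le_of_mem hp hx)).1, hL.2]) ?_
  intro e he h x hx
  obtain ⟨hc0, hc1⟩ := mul_foldedPhi_mem hp hx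
  have hstep := meanLower_le_step hp hx
  have hnext := h _ (foldedPhi_mem hp (foldedPhi_mem hp hx))
  rw [wMean_foldedPhi_foldedPhi (mem_Icc_half hp) hx.1]
  nlinarith

theorem wMean_le_meanUpper (hx : x ∈ Icc (1 / 2) p) : wMean p x ≤ meanUpper p := by
  have hU := meanUpper_mem hp
  suffices h : ∀ x ∈ Icc (1 / 2) p, wMean p x - meanUpper p ≤ 0 from sub_nonpos.1 (h x hx)
  refine nonpos_of_contracting (c := 1 / 2) (B := 40) (by norm_num)
    (fun x hx => by linarith [(abs_le.1 (abs_wMean_le_of_mem hp hx)).2, hU.1]) ?_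
  intro e he h x hx
  obtain ⟨hc0, hc1⟩ := mul_foldedPhi_mem hp hx
  have hstep := step_le_meanUpper hp hx
  have hnext := h _ (foldedPhi_mem hp (foldedPhi_mem hp hx))
  rw [wMean_foldedPhi_foldedPhi (mem_Icc_half hp) hx.1]
  nlinarith

theorem wMean_le_of_lt (hx : 1 / 2 ≤ x) (h : x < 2 / 3) :
    wMean p x ≤ 5 / 3 + meanUpper p / 3 := by
  have hmem : x ∈ Icc (1 / 2) p := ⟨hx, by linarith [hp.1]⟩
  have hnext := wMean_le_meanUpper hp (foldedPhi_mem hp (foldedPhi_mem hp hmem))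
  rw [wMean_foldedPhi_foldedPhi (mem_Icc_half hp) hx]
  linarith [step_le_of_lt hp hx h,
    mul_le_mul_of_nonneg_left hnext (mul_foldedPhi_mem hp hmem).1]

theorem one_add_mul_meanLower_le (hx : x ∈ Icc (1 / 2) p) : 1 + x * meanLower p ≤ wMean p x := by
  rw [wMean_foldedPhi (mem_Icc_half hp) hx.1]
  linarith [mul_le_mul_of_nonneg_left (meanLower_le_wMean hp (foldedPhi_mem hp hx))
    (show 0 ≤ x by linarith [hx.1])]

end Orbit

/-! ## Bounds of `wDiff` -/

section Diff

variable (hp : p ∈ Icc (2 / 3 : ℝ) (18 / 25))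
include hp

theorem mul_foldedPhi_add (h : 1 / 2 ≤ x) (h' : x < 2 / 3) :
    x * (foldedPhi p x + (3 * p - 2)) = 2 * p - 1 := by
  linear_combination mul_foldedPhi_of_lt hp h h'

theorem foldedPhi_add_mem (h : 1 / 2 ≤ x) (h' : x < 2 / 3) :
    foldedPhi p x + (3 * p - 2) ∈ Icc (0 : ℝ) (22 / 25) := by
  have hmul := mul_foldedPhi_add hp h h'
  constructor <;> nlinarith [hp.1, hp.2]

theorem sub_foldedPhi_mem (hx : x ∈ Icc (1 / 2) p) :
    3 * p - 1 - foldedPhi p x ∈ Icc (0 : ℝ) (33 / 50) := by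
  have h := foldedPhi_mem hp hx
  constructor <;> linarith [h.1, h.2, hp.1, hp.2]

theorem one_sub_half_le_foldedPhi (hy : 1 / 2 ≤ y) (hy' : y ≤ foldedPhi p p) :
    1 - p / 2 ≤ foldedPhi p y := by
  have hlt : foldedPhi p p < 2 / 3 := foldedPhi_lt hp ⟨hp.1, le_rfl⟩
  have hp0 : 0 < p := by linarith [hp.1]
  have hmul := mul_foldedPhi_of_lt hp hy (hy'.trans_lt hlt)
  have hmulp := mul_foldedPhi_of_ge hp hp.1
  have hcubic : 0 ≤ (p - 2 / 3) * (p - p ^ 2 - 1 / 5) :=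
    mul_nonneg (by linarith [hp.1]) (by nlinarith [hp.1, hp.2])
  have hfar : foldedPhi p p * (5 * p / 2 - 1) ≤ 2 * p - 1 := by
    refine le_of_mul_le_mul_left ?_ hp0
    linear_combination 15 / 2 * hcubic + (5 * p / 2 - 1) * hmulp
  refine le_of_mul_le_mul_left ?_ (show 0 < y by linarith)
  linear_combination hfar - hmul
    + mul_le_mul_of_nonneg_right hy' (show 0 ≤ 5 * p / 2 - 1 by linarith [hp.1])

theorem foldedPhi_mul_le (hx : 1 - p / 2 ≤ x) (h : x < 2 / 3) :
    foldedPhi p x * (3 * p - 4 / 3) ≤ 2 * p - 1 := by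
  have hmul := mul_foldedPhi_of_lt hp (by linarith [hp.2]) h
  have hcubic : 0 ≤ (p - 2 / 3) * (8 * p - 9 * p ^ 2 - 1) :=
    mul_nonneg (by linarith [hp.1]) (by nlinarith [hp.1, hp.2])
  have hcoef : 0 ≤ 2 * p - 1 + (3 * p - 2) * (3 * p - 4 / 3) := by nlinarith [hp.1]
  refine le_of_mul_le_mul_left ?_ (show 0 < x by linarith [hp.2])
  linear_combination hcubic / 2 + (3 * p - 4 / 3) * hmul + mul_le_mul_of_nonneg_right hx hcoef

theorem foldedPhi_le (hx : 1 - p / 2 ≤ x) (h : x < 2 / 3) : foldedPhi p x ≤ 3 * p / 4 := by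
  have hmul := foldedPhi_mul_le hp hx h
  nlinarith [hp.1, sq_nonneg (3 * p - 2)]

theorem two_thirds_le_foldedPhi_foldedPhi (hx : 1 - p / 2 ≤ x) (h : x < 2 / 3) :
    2 / 3 ≤ foldedPhi p (foldedPhi p x) := by
  have hhalf := half_le_foldedPhi p x
  have hmul := mul_foldedPhi_of_lt hp hhalf (by linarith [foldedPhi_le hp hx h, hp.2])
  refine le_of_mul_le_mul_left ?_ (show 0 < foldedPhi p x by linarith)
  linear_combination foldedPhi_mul_le hp hx h - hmul

theorem wMean_le_of_far (hx : 1 - p / 2 ≤ x) (h : x < 2 / 3) :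
    wMean p (foldedPhi p x) ≤ 1 + 3 * p / 4 * meanUpper p := by
  have hhalf := half_le_foldedPhi p x
  have hmem : foldedPhi p (foldedPhi p x) ∈ Icc (1 / 2) p :=
    foldedPhi_mem hp (foldedPhi_mem hp ⟨by linarith [hp.2], by linarith [hp.1]⟩)
  rw [wMean_foldedPhi (mem_Icc_half hp) hhalf, add_le_add_iff_left]
  refine mul_le_mul (foldedPhi_le hp hx h) (wMean_le_meanUpper hp hmem) ?_ (by linarith [hp.1])
  exact wMean_nonneg (mem_Icc_half hp) _

theorem wDiff_of_lt_of_ge (h : 1 / 2 < x) (h' : x < 2 / 3) (hF : 2 / 3 ≤ foldedPhi p x) :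
    wDiff p x = 1 - (3 * p - 2) * wMean p (foldedPhi p (foldedPhi p x))
      - (foldedPhi p x + (3 * p - 2)) * (3 * p - 1 - foldedPhi p (foldedPhi p x))
        * wDiff p (foldedPhi p (foldedPhi p x)) := by
  rw [wDiff_of_lt hp h h', wDiff_of_ge hp hF,
    wMean_foldedPhi (mem_Icc_half hp) (half_le_foldedPhi p x)]
  ring

theorem wDiff_le_of_far (he : ∀ t ∈ Icc (1 / 2) p, -e ≤ wDiff p t) (he0 : 0 ≤ e)
    (hx : 1 - p / 2 ≤ x) (h : x < 2 / 3) :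
    wDiff p (foldedPhi p x) ≤ 1 - (3 * p - 2) * meanLower p + 3 / 5 * e := by
  have hL := one_sub_mul_meanLower_nonneg hp
  have hhalf := half_le_foldedPhi p x
  have hlt : foldedPhi p x < 2 / 3 := by linarith [foldedPhi_le hp hx h, hp.2]
  have hge := two_thirds_le_foldedPhi_foldedPhi hp hx h
  set w := foldedPhi p x
  have hu : foldedPhi p w ∈ Icc (1 / 2) p := foldedPhi_mem hp ⟨hhalf, by linarith [hp.1]⟩
  have ht : foldedPhi p (foldedPhi p w) ∈ Icc (1 / 2) p := foldedPhi_mem hp hu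
  rcases hhalf.eq_or_lt with hw | hw
  · rw [← hw, wDiff_half (mem_Icc_half hp)]
    linarith
  · obtain ⟨ha0, ha1⟩ := foldedPhi_add_mem hp hw.le hlt
    obtain ⟨hb0, hb1⟩ := sub_foldedPhi_mem hp hu
    rw [wDiff_of_lt_of_ge hp hw hlt hge]
    have hmean := mul_le_mul_of_nonneg_left (meanLower_le_wMean hp ht)
      (show 0 ≤ 3 * p - 2 by linarith [hp.1])
    have hab := mul_le_mul ha1 hb1 hb0 (by norm_num)
    nlinarith [mul_le_mul_of_nonneg_left (he _ ht) (mul_nonneg ha0 hb0)]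

section Weighted

variable {c M : ℝ} (hc : c ∈ Icc p (3 * p - 1))

include hc in
theorem weight_coef_nonneg : 0 ≤ 2 * p - 1 - c * (3 * p - 2) := by
  nlinarith [hc.2, hp.1, hp.2]

include hc in
theorem weight_le (hy : 1 / 2 ≤ y) (h : y < 2 / 3) (hz : foldedPhi p y < 2 / 3) :
    (c - y) * ((foldedPhi p y + (3 * p - 2)) * (foldedPhi p (foldedPhi p y) + (3 * p - 2)))
      ≤ (2 * c - 1) * (2 * p - 1) ^ 2 / p := by
  have hz0 := half_le_foldedPhi p y
  have hyz := mul_foldedPhi_of_lt hp hy h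
  have hyk := mul_foldedPhi_add hp hy h
  have hzk := mul_foldedPhi_add hp hz0 hz
  set z := foldedPhi p y
  set w := foldedPhi p z
  have hcoef : 0 ≤ (2 * p - 1) ^ 2 * ((2 * y - 1) * (2 * p - 1 - c * (3 * p - 2))) :=
    mul_nonneg (sq_nonneg _) (mul_nonneg (by linarith) (weight_coef_nonneg hp hc))
  rw [le_div_iff₀ (by linarith [hp.1])]
  refine le_of_mul_le_mul_left ?_ (show 0 < y * z by nlinarith)
  linear_combination hcoef + p * (c - y) * (z * (w + (3 * p - 2))) * hyk
    + p * (c - y) * (2 * p - 1) * hzk - (2 * c - 1) * (2 * p - 1) ^ 2 * hyz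

variable (he : ∀ t ∈ Icc (1 / 2) p, -e ≤ wDiff p t)
  (he0 : 0 ≤ e) (hy' : y ≤ foldedPhi p p)
include hc he he0 hy'

theorem weighted_le_of_ge (hy : 1 / 2 < y) (h : 2 / 3 ≤ foldedPhi p y)
    (hM : 1 + c + (2 * p - 1 - c * (3 * p - 2)) * (5 / 3 + meanUpper p / 3) ≤ M) :
    wMean p y + (c - y) * wDiff p y ≤ M + 9 / 10 * e := by
  have hlt : y < 2 / 3 := hy'.trans_lt (foldedPhi_lt hp ⟨hp.1, le_rfl⟩)
  have hz : foldedPhi p y ∈ Icc (1 / 2) p := foldedPhi_mem hp ⟨hy.le, by linarith [hp.1]⟩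
  have hw := foldedPhi_mem hp hz
  have hmul := mul_foldedPhi_add hp hy.le hlt
  obtain ⟨ha0, ha1⟩ := foldedPhi_add_mem hp hy.le hlt
  obtain ⟨hb0, hb1⟩ := sub_foldedPhi_mem hp hz
  have hcoef := weight_coef_nonneg hp hc
  have hcy0 : 0 ≤ c - y := by linarith [hc.1, hp.1]
  have hcy1 : c - y ≤ 1 := by linarith [hc.2, hp.2]
  have hmean := mul_le_mul_of_nonneg_left
    (wMean_le_of_lt hp hw.1 (foldedPhi_lt hp ⟨h, hz.2⟩)) hcoef
  rw [wDiff_of_lt hp hy hlt, wDiff_of_ge hp h, wMean_foldedPhi (mem_Icc_half hp) hy.le,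
    wMean_foldedPhi (mem_Icc_half hp) hz.1]
  set z := foldedPhi p y
  set w := foldedPhi p z
  have hweight0 : 0 ≤ (c - y) * ((z + (3 * p - 2)) * (3 * p - 1 - w)) := by positivity
  have hweight1 : (c - y) * ((z + (3 * p - 2)) * (3 * p - 1 - w)) ≤ 9 / 10 :=
    (mul_le_mul hcy1 (mul_le_mul ha1 hb1 hb0 (by norm_num)) (by positivity) zero_le_one).trans
      (by norm_num)
  linear_combination hM + hmean + mul_le_mul_of_nonneg_left (he w hw) hweight0
    + mul_le_mul_of_nonneg_right hweight1 he0 + wMean p w * hmul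

theorem weighted_le_of_lt (hy : 1 / 2 < y) (h : foldedPhi p y < 2 / 3)
    (hM : 1 + c + (2 * p - 1 - c * (3 * p - 2)) * (1 + 3 * p / 4 * meanUpper p)
      + (2 * c - 1) * (2 * p - 1) ^ 2 / p * (1 - (3 * p - 2) * meanLower p) ≤ M) :
    wMean p y + (c - y) * wDiff p y ≤ M + 9 / 10 * e := by
  have hlt : y < 2 / 3 := hy'.trans_lt (foldedPhi_lt hp ⟨hp.1, le_rfl⟩)
  have hfar := one_sub_half_le_foldedPhi hp hy.le hy'
  have hz : 1 / 2 < foldedPhi p y := by linarith [hp.2]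
  have hw := foldedPhi_mem hp (foldedPhi_mem hp ⟨hy.le, by linarith [hp.1]⟩)
  have hmul := mul_foldedPhi_add hp hy.le hlt
  have hL := one_sub_mul_meanLower_nonneg hp
  obtain ⟨ha0, ha1⟩ := foldedPhi_add_mem hp hy.le hlt
  obtain ⟨hb0, hb1⟩ := foldedPhi_add_mem hp hz.le h
  have hcoef := weight_coef_nonneg hp hc
  have hcy0 : 0 ≤ c - y := by linarith [hc.1, hp.1]
  have hcy1 : c - y ≤ 1 := by linarith [hc.2, hp.2]
  have hmean := mul_le_mul_of_nonneg_left (wMean_le_of_far hp hfar h) hcoef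
  have hdiff := wDiff_le_of_far hp he he0 hfar h
  have hweight := mul_le_mul_of_nonneg_right (weight_le hp hc hy.le hlt h) hL
  rw [wDiff_of_lt hp hy hlt, wDiff_of_lt hp hz h, wMean_foldedPhi (mem_Icc_half hp) hy.le,
    wMean_foldedPhi (mem_Icc_half hp) hz.le]
  set z := foldedPhi p y
  set w := foldedPhi p z
  have hweight0 : 0 ≤ (c - y) * ((z + (3 * p - 2)) * (w + (3 * p - 2))) := by positivity
  have hweight1 : (c - y) * ((z + (3 * p - 2)) * (w + (3 * p - 2))) ≤ 1 :=
    (mul_le_mul hcy1 (mul_le_mul ha1 hb1 hb0 (by norm_num)) (by positivity) zero_le_one).trans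
      (by norm_num)
  linear_combination hM + hmean + mul_le_mul_of_nonneg_left hdiff hweight0 + hweight
    + 3 / 5 * mul_le_mul_of_nonneg_right hweight1 he0 + 3 / 10 * he0 + wMean p w * hmul

theorem weighted_le (hy : 1 / 2 ≤ y) (hM : 5 / 3 + meanUpper p / 3 ≤ M)
    (hMge : 1 + c + (2 * p - 1 - c * (3 * p - 2)) * (5 / 3 + meanUpper p / 3) ≤ M)
    (hMlt : 1 + c + (2 * p - 1 - c * (3 * p - 2)) * (1 + 3 * p / 4 * meanUpper p)
      + (2 * c - 1) * (2 * p - 1) ^ 2 / p * (1 - (3 * p - 2) * meanLower p) ≤ M) :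
    wMean p y + (c - y) * wDiff p y ≤ M + 9 / 10 * e := by
  rcases hy.eq_or_lt with rfl | hy
  · rw [wDiff_half (mem_Icc_half hp)]
    linarith [wMean_le_of_lt hp le_rfl (show (1 / 2 : ℝ) < 2 / 3 by norm_num)]
  · rcases lt_or_ge (foldedPhi p y) (2 / 3) with h | h
    · exact weighted_le_of_lt hp hc he he0 hy' hy h hMlt
    · exact weighted_le_of_ge hp hc he he0 hy' hy h hMge

end Weighted

theorem foldedPhi_le_foldedPhi (hx : 2 / 3 ≤ x) (hxy : x ≤ y) : foldedPhi p x ≤ foldedPhi p y := by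
  have hmulx := mul_foldedPhi_of_ge hp hx
  have hmuly := mul_foldedPhi_of_ge hp (hx.trans hxy)
  refine le_of_mul_le_mul_left ?_ (show 0 < x * y by nlinarith)
  nlinarith [hp.1]

theorem neg_le_wDiff_step (hu : ∀ t ∈ Icc (1 / 2) p, wDiff p t ≤ diffUpper p + e)
    (hl : ∀ t ∈ Icc (1 / 2) p, -e ≤ wDiff p t) (he : 0 ≤ e) (hx : x ∈ Icc (1 / 2) p) :
    -(9 / 10 * e) ≤ wDiff p x := by
  have hz := foldedPhi_mem hp hx
  have hmean := one_add_mul_meanLower_le hp hz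
  rcases hx.1.eq_or_lt with rfl | hx2
  · rw [wDiff_half (mem_Icc_half hp)]
    linarith
  rcases lt_or_ge x (2 / 3) with h | h
  · obtain ⟨ha0, ha1⟩ := foldedPhi_add_mem hp hx.1 h
    have hLD : meanLower p ≤ diffUpper p := by linarith [(meanLower_mem hp).2, le_diffUpper hp]
    rw [wDiff_of_lt hp hx2 h]
    linear_combination hmean + mul_le_mul_of_nonneg_left (hu _ hz) ha0
      + mul_nonneg (sub_nonneg.2 hz.2) (sub_nonneg.2 hLD) + mul_le_mul_of_nonneg_right ha1 he
      + he / 50 + two_mul_diffUpper hp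
  · obtain ⟨hb0, hb1⟩ := sub_foldedPhi_mem hp hx
    have hmean0 := wMean_nonneg (mem_Icc_half hp) (foldedPhi p x)
    rw [wDiff_of_ge hp h]
    nlinarith [mul_le_mul_of_nonneg_left (hl _ hz) hb0]

theorem wDiff_step_le (hl : ∀ t ∈ Icc (1 / 2) p, -e ≤ wDiff p t) (he : 0 ≤ e)
    (hx : x ∈ Icc (1 / 2) p) : wDiff p x ≤ diffUpper p + 9 / 10 * e := by
  have hz := foldedPhi_mem hp hx
  have hU := meanUpper_mem hp
  have hD := le_diffUpper hp
  rcases hx.1.eq_or_lt with rfl | hx2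
  · rw [wDiff_half (mem_Icc_half hp)]
    linarith
  rcases lt_or_ge x (2 / 3) with h | h
  · obtain ⟨ha0, ha1⟩ := foldedPhi_add_mem hp hx.1 h
    rw [wDiff_of_lt hp hx2 h]
    linear_combination wMean_le_meanUpper hp hz + hU.2 + hD
      + mul_le_mul_of_nonneg_left (hl _ hz) ha0 + mul_le_mul_of_nonneg_right ha1 he + he / 50
  · rw [wDiff_of_ge hp h]
    exact weighted_le hp ⟨by linarith [hp.1], le_rfl⟩ hl he (foldedPhi_le_foldedPhi hp h hx.2) hz.1
      (by linarith [hU.2]) (diff_bound_of_ge hp) (diff_bound_of_lt hp)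

theorem wDiff_mem (hx : x ∈ Icc (1 / 2) p) : wDiff p x ∈ Icc 0 (diffUpper p) := by
  have hD := le_diffUpper hp
  suffices h : ∀ x ∈ Icc (1 / 2) p, max (-wDiff p x) (wDiff p x - diffUpper p) ≤ 0 by
    obtain ⟨h0, h1⟩ := max_le_iff.1 (h x hx)
    exact ⟨neg_nonpos.1 h0, sub_nonpos.1 h1⟩
  refine nonpos_of_contracting (c := 9 / 10) (B := 80) (by norm_num) (fun x _ => ?_)
    fun e he h x hx => ?_
  · have habs := abs_le.1 (abs_wDiff_le (mem_Icc_half hp) x)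
    exact max_le (by linarith [habs.1]) (by linarith [habs.2])
  · have hl : ∀ t ∈ Icc (1 / 2) p, -e ≤ wDiff p t := fun t ht =>
      neg_le.1 ((le_max_left _ _).trans (h t ht))
    have hu : ∀ t ∈ Icc (1 / 2) p, wDiff p t ≤ diffUpper p + e := fun t ht =>
      sub_le_iff_le_add'.1 ((le_max_right _ _).trans (h t ht))
    exact max_le (neg_le.1 (neg_le_wDiff_step hp hu hl he hx))
      (sub_le_iff_le_add'.2 (wDiff_step_le hp hl he hx))

end Diff

/-! ## The strategy of Player 2 -/

section Successor

variable (hp : p ∈ Icc (2 / 3 : ℝ) (18 / 25))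
include hp

theorem abs_wDiff_le_diffUpper (hθ : θ ∈ Icc (1 - p) p) : |wDiff p θ| ≤ diffUpper p := by
  rcases le_total (1 / 2) θ with h | h
  · obtain ⟨h0, h1⟩ := wDiff_mem hp (x := θ) ⟨h, hθ.2⟩
    exact abs_le.2 ⟨by linarith, h1⟩
  · obtain ⟨h0, h1⟩ := wDiff_mem hp (x := 1 - θ) ⟨by linarith, by linarith [hθ.1]⟩
    rw [wDiff_symm (mem_Icc_half hp)] at h0 h1
    exact abs_le.2 ⟨by linarith, by linarith⟩

theorem mul_wDiff_sub_le (hθ : θ ∈ Icc (1 - p) p) :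
    (2 * p - 1) * (wDiff p p - wDiff p θ) ≤ wMean p p := by
  have hpp := (wDiff_mem hp ⟨by linarith [hp.1], le_refl p⟩).2
  have hθ := (abs_le.1 (abs_wDiff_le_diffUpper hp hθ)).1
  calc (2 * p - 1) * (wDiff p p - wDiff p θ) ≤ (2 * p - 1) * (2 * diffUpper p) :=
        mul_le_mul_of_nonneg_left (by linarith) (by linarith [hp.1])
    _ = 1 + p * meanLower p := by linarith [two_mul_diffUpper hp]
    _ ≤ wMean p p := one_add_mul_meanLower_le hp ⟨by linarith [hp.1], le_rfl⟩

theorem wMean_add_mul_wDiff_nonneg (hθ : θ ∈ Icc (1 - p) p) :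
    0 ≤ wMean p θ + (p - θ) * wDiff p θ := by
  rcases le_total (1 / 2) θ with h | h
  · have hdiff := (wDiff_mem hp (x := θ) ⟨h, hθ.2⟩).1
    exact add_nonneg (wMean_nonneg (mem_Icc_half hp) θ)
      (mul_nonneg (sub_nonneg.2 hθ.2) hdiff)
  · have hmem : 1 - θ ∈ Icc (1 / 2) p := ⟨by linarith, by linarith [hθ.1]⟩
    have hmean := meanLower_le_wMean hp hmem
    obtain ⟨h0, h1⟩ := wDiff_mem hp hmem
    rw [wMean_symm (mem_Icc_half hp)] at hmean
    rw [wDiff_symm (mem_Icc_half hp)] at h0 h1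
    have hmul : (p - θ) * -wDiff p θ ≤ (2 * p - 1) * diffUpper p :=
      mul_le_mul (by linarith [hθ.1]) h1 h0 (by linarith [hp.1])
    linarith [diffUpper_mul_le hp]

theorem wMean_add_mul_wDiff_one_sub_le (hθ : θ ∈ Icc (1 / 2) p) :
    wMean p (1 - θ) + (p - (1 - θ)) * wDiff p (1 - θ) ≤ 1 + p * meanLower p := by
  have hcoef : 0 ≤ p - (1 - θ) := by linarith [hθ.1, hp.1]
  rw [wMean_symm (mem_Icc_half hp), wDiff_symm (mem_Icc_half hp)]
  rcases lt_or_ge θ (2 / 3) with h | h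
  · linarith [mul_nonneg hcoef (wDiff_mem hp hθ).1, wMean_le_of_lt hp hθ.1 h, mean_bound_le hp]
  · have hw := foldedPhi_mem hp hθ
    have hmean := wMean_le_meanUpper hp hw
    have hdiff : wMean p (foldedPhi p θ) ≤ wDiff p θ := by
      rw [wDiff_of_ge hp h]
      exact le_add_of_nonneg_right (mul_nonneg (sub_foldedPhi_mem hp hθ).1 (wDiff_mem hp hw).1)
    rw [wMean_foldedPhi (mem_Icc_half hp) hθ.1]
    have hL := meanLower_mem hp
    have hU := meanUpper_mem hp
    have hconst : (1 - p) * meanUpper p ≤ p * meanLower p := by nlinarith [hL.1, hU.2, hp.1, hp.2]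
    have hmean' : (1 - p) * wMean p (foldedPhi p θ) ≤ (1 - p) * meanUpper p :=
      mul_le_mul_of_nonneg_left hmean (by linarith [hp.2])
    linarith [mul_le_mul_of_nonneg_left hdiff hcoef]

theorem wMean_add_mul_wDiff_Phi_le (h : 1 / 2 ≤ θ) (hθ : θ ≤ p) :
    wMean p (Phi p θ) + (p - Phi p θ) * wDiff p (Phi p θ) ≤ wMean p p := by
  refine le_trans ?_ (one_add_mul_meanLower_le hp ⟨by linarith [hp.1], le_rfl⟩)
  have hmem := foldedPhi_mem hp ⟨h, hθ⟩
  rcases lt_or_ge θ (2 / 3) with hlt | hge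
  · rw [foldedPhi_of_lt hp h hlt] at hmem
    have hbound := wMean_add_mul_wDiff_one_sub_le hp hmem
    rwa [sub_sub_cancel] at hbound
  · have hbound := weighted_le hp (c := p) (e := 0) ⟨le_rfl, by linarith [hp.1]⟩
      (fun t ht => by rw [neg_zero]; exact (wDiff_mem hp ht).1) le_rfl
      (foldedPhi_le_foldedPhi hp hge hθ) hmem.1 (mean_bound_le hp) (prob_bound_of_ge hp)
      (prob_bound_of_lt hp)
    rwa [mul_zero, add_zero, foldedPhi_of_ge hp hge] at hbound

end Successor

/-- The relative score of Player 1 in the position `(s, θ)`. -/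
noncomputable def relScore (p : ℝ) : Sys → ℝ → ℝ
  | .lo => scoreG p
  | .hi => scoreH p

/-- Against the mixed action `x(θ)` of Player 2 no action of Player 1 increases the gain of the
current stage plus the expected relative score of the next position by more than `v`. -/
def ScoreDominates (p θ : ℝ) : Prop :=
  ∀ s a, mix (xStar p θ) (stageGain s a .L) (stageGain s a .R)
    + mix p (relScore p s (belief p θ [a])) (relScore p s.flip (belief p θ [a]))
    ≤ relScore p s θ + vStar p

theorem ZStar_eq (p : ℝ) : ZStar p = wDiff p p * vStar p / 2 := rfl

theorem mix_stageGain_flip (x : ℝ) : ∀ s a,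
    mix (1 - x) (stageGain s a .L) (stageGain s a .R)
      = mix x (stageGain s.flip a.flip .L) (stageGain s.flip a.flip .R)
  | .lo, .T => by simp only [mix, Sys.flip, Act1.flip, stageGain]; ring
  | .lo, .B => by simp only [mix, Sys.flip, Act1.flip, stageGain]; ring
  | .hi, .T => by simp only [mix, Sys.flip, Act1.flip, stageGain]; ring
  | .hi, .B => by simp only [mix, Sys.flip, Act1.flip, stageGain]; ring

section Scores

variable (hp : p ∈ Icc (1 / 2 : ℝ) (3 / 4))
include hp

theorem relScore_one_sub (θ : ℝ) : ∀ s, relScore p s (1 - θ) = relScore p s.flip θ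
  | .lo => score_symm hp θ
  | .hi => by
    have h := score_symm hp (1 - θ)
    rw [sub_sub_cancel] at h
    exact h.symm

theorem abs_relScore_le (θ : ℝ) :
    ∀ s, |relScore p s θ| ≤ |1 - gam p * ZStar p| + 40 := by
  have hv := vStar_mem hp
  have key : ∀ i, |1 - gam p * ZStar p - vStar p * wVec p θ i| ≤ |1 - gam p * ZStar p| + 40 := by
    intro i
    refine (abs_sub _ _).trans (add_le_add le_rfl ?_)
    rw [abs_mul, abs_of_pos hv.1]
    exact (mul_le_of_le_one_left (abs_nonneg _) hv.2).trans (abs_wVec_le hp θ i)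
  rintro (_ | _)
  exacts [key 0, key 1]

theorem xStar_one_sub (θ : ℝ) : xStar p (1 - θ) = 1 - xStar p θ := by
  have hG : scoreG p (1 - θ) = scoreH p θ := relScore_one_sub hp θ .lo
  have hH : scoreH p (1 - θ) = scoreG p θ := relScore_one_sub hp θ .hi
  rcases lt_trichotomy θ (1 / 2) with h | rfl | h
  · rw [xStar, xStar, if_pos (by linarith), if_neg (by linarith), if_pos h, hG]
    ring
  · norm_num [xStar]
  · rw [xStar, xStar, if_neg (by linarith), if_pos (by linarith), if_pos h, hH]

theorem xStar_of_gt (h : 1 / 2 < θ) :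
    xStar p θ = 1 - vStar p * (wMean p (Phi p θ) + (p - Phi p θ) * wDiff p (Phi p θ)) := by
  rw [xStar, if_pos h, scoreG, (wVec_of_gt hp h).1]
  ring

theorem ScoreDominates.one_sub (h : ScoreDominates p θ) : ScoreDominates p (1 - θ) := by
  intro s a
  have hbelief : belief p (1 - θ) [a] = 1 - belief p θ [a.flip] := by
    rw [← belief_one_sub]
    cases a <;> rfl
  rw [xStar_one_sub hp, mix_stageGain_flip, hbelief, relScore_one_sub hp, relScore_one_sub hp,
    relScore_one_sub hp]
  exact h s.flip a.flip

end Scores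

section Optimal

variable (hp : p ∈ Icc (2 / 3 : ℝ) (18 / 25))
include hp

theorem Phi_mem (h : 1 / 2 ≤ θ) (hθ : θ ≤ p) : Phi p θ ∈ Icc (1 - p) p := by
  rw [Phi_of_half_le h]
  exact fB_mem (mem_Icc_one hp) ⟨by linarith [hp.1], hθ⟩

theorem xStar_mem_of_gt (h : 1 / 2 < θ) (hθ : θ ≤ p) : xStar p θ ∈ Icc (0 : ℝ) 1 := by
  have hv := (vStar_mem (mem_Icc_half hp)).1.le
  have hnonneg := mul_nonneg hv (wMean_add_mul_wDiff_nonneg hp (Phi_mem hp h.le hθ))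
  have hle := mul_le_mul_of_nonneg_left (wMean_add_mul_wDiff_Phi_le hp h.le hθ) hv
  rw [vStar_mul_wMean_self (mem_Icc_half hp)] at hle
  rw [xStar_of_gt (mem_Icc_half hp) h]
  exact ⟨by linarith, by linarith⟩

theorem gam_mul_ZStar_le (hθ : θ ∈ Icc (1 - p) p) :
    2 * gam p * ZStar p - gam p * (vStar p * wDiff p θ) ≤ 1 := by
  have h := mul_le_mul_of_nonneg_left (mul_wDiff_sub_le hp hθ) (vStar_mem (mem_Icc_half hp)).1.le
  rw [vStar_mul_wMean_self (mem_Icc_half hp)] at h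
  rw [ZStar_eq, gam]
  linarith

theorem scoreDominates_of_gt (h : 1 / 2 < θ) (hθ : θ ≤ p) : ScoreDominates p θ := by
  have hp' := mem_Icc_half hp
  have hZ := gam_mul_ZStar_le hp (Phi_mem hp h.le hθ)
  have hx : xStar p θ = scoreG p θ + vStar p + gam p * ZStar p := if_pos h
  have hH : scoreH p θ = 1 - gam p * ZStar p - vStar p * wVec p θ 1 := rfl
  rw [(wVec_of_gt hp' h).2] at hH
  obtain ⟨hG_base, hH_base⟩ := score_base hp'
  obtain ⟨hG_gt, hH_gt⟩ := score_gt hp' h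
  have hT : belief p θ [.T] = p := fT_of_half_le h.le
  have hB : belief p θ [.B] = Phi p θ := (Phi_of_half_le h.le).symm
  rintro (_ | _) (_ | _) <;>
    simp only [relScore, Sys.flip, stageGain, mix, hT, hB, hG_base, hH_base]
  · rw [hx, gam]
    linarith
  · linarith
  · rw [hH]
    rw [gam] at hZ ⊢
    linarith
  · rw [hx, hH_gt, hG_gt, gam]
    linarith

theorem scoreDominates_half : ScoreDominates p (1 / 2) := by
  have hp' := mem_Icc_half hp
  have hZ : 4 * gam p * ZStar p ≤ 1 := by
    have h := gam_mul_ZStar_le hp (θ := 1 - p) ⟨le_rfl, by linarith [hp.1]⟩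
    rw [wDiff_symm hp'] at h
    linarith [ZStar_eq p, congrArg (gam p * ·) (ZStar_eq p)]
  have hx : xStar p (1 / 2) = 1 / 2 := by norm_num [xStar]
  obtain ⟨hG_base, hH_base⟩ := score_base hp'
  obtain ⟨hG_half, hH_half⟩ := score_half hp'
  have hG_symm : scoreG p (1 - p) = scoreH p p := score_symm hp' p
  have hH_symm : scoreH p (1 - p) = scoreG p p := relScore_one_sub hp' p .hi
  have hT : belief p (1 / 2) [.T] = p := fT_of_half_le le_rfl
  have hB : belief p (1 / 2) [.B] = 1 - p := fB_of_le_half le_rfl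
  rw [gam] at hZ hG_half hH_half
  rintro (_ | _) (_ | _) <;>
    simp only [relScore, Sys.flip, stageGain, mix, hx, hT, hB, hG_symm, hH_symm, hG_base, hH_base,
      hG_half, hH_half] <;>
    linarith

theorem scoreDominates (hθ : θ ∈ Icc (1 - p) p) : ScoreDominates p θ := by
  rcases lt_trichotomy θ (1 / 2) with h | rfl | h
  · have hdom := (scoreDominates_of_gt hp (θ := 1 - θ) (by linarith) (by linarith [hθ.1])).one_sub
      (mem_Icc_half hp)
    rwa [sub_sub_cancel] at hdom
  · exact scoreDominates_half hp
  · exact scoreDominates_of_gt hp h hθ.2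

theorem xStar_mem (hθ : θ ∈ Icc (1 - p) p) : xStar p θ ∈ Icc (0 : ℝ) 1 := by
  rcases lt_trichotomy θ (1 / 2) with h | rfl | h
  · have hx := xStar_mem_of_gt hp (θ := 1 - θ) (by linarith) (by linarith [hθ.1])
    rw [xStar_one_sub (mem_Icc_half hp)] at hx
    exact ⟨by linarith [hx.2], by linarith [hx.1]⟩
  · norm_num [xStar]
  · exact xStar_mem_of_gt hp h hθ.2

theorem isStrategy2_automatonStrategy_xStar (hθ : θ ∈ Icc (1 - p) p) :
    IsStrategy2 (automatonStrategy p θ (xStar p)) := fun _ =>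
  xStar_mem hp (belief_mem (mem_Icc_one hp) hθ _)

theorem guarantees2_xStar {q : ℝ} (hq : q ∈ Icc (0 : ℝ) 1) (hθ : θ ∈ Icc (1 - p) p) :
    Guarantees2 p q (automatonStrategy p θ (xStar p)) (vStar p) := by
  refine guarantees2_of_bound (C := 2 * (|1 - gam p * ZStar p| + 40)) hq fun σ hσ n s => ?_
  have hgain := expGain_le_of_potential (mem_Icc_one hp) hθ (fun η hη => xStar_mem hp hη)
    (fun η hη => scoreDominates hp hη)
    (fun η _ s => (abs_le.1 (abs_relScore_le (mem_Icc_half hp) η s)).1) hσ n [] s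
  have hscore := (abs_le.1 (abs_relScore_le (mem_Icc_half hp) (internalState p θ []) s)).2
  linarith

end Optimal

end AsymGame

theorem mainTheorem3_general (p : ℝ) (hp : 2 / 3 ≤ p) (hp' : p ≤ 18 / 25)
    (q : ℝ) (hq : q ∈ Set.Icc (0 : ℝ) 1) (θ₀ : ℝ) (hθ₀ : θ₀ ∈ Set.Icc (1 - p) p) :
    AsymGame.IsOptimal1 p q (AsymGame.sigmaStar p θ₀) ∧
      AsymGame.IsOptimal2 p q (AsymGame.automatonStrategy p θ₀ (AsymGame.xStar p)) :=
  open AsymGame in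
  have hp : p ∈ Icc (2 / 3 : ℝ) (18 / 25) := ⟨hp, hp'⟩
  have hp1 : p ∈ Ico (1 / 2 : ℝ) 1 := ⟨by linarith [hp.1], by linarith [hp.2]⟩
  optimal_of_guarantees (isStrategy1_sigmaStar hp1 hθ₀) (isStrategy2_automatonStrategy_xStar hp hθ₀)
    (guarantees1_sigmaStar (mem_Icc_half hp) hq hθ₀) (guarantees2_xStar hp hq hθ₀)

theorem mainTheorem3 (p : ℝ) (hp : 2 / 3 ≤ p) (hp' : p ≤ 0.719023)
    (q : ℝ) (hq : q ∈ Set.Icc (0 : ℝ) 1) (θ₀ : ℝ) (hθ₀ : θ₀ ∈ Set.Icc (1 - p) p) :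
    AsymGame.IsOptimal1 p q (AsymGame.sigmaStar p θ₀) ∧
      AsymGame.IsOptimal2 p q (AsymGame.automatonStrategy p θ₀ (AsymGame.xStar p)) :=
  mainTheorem3_general p hp (hp'.trans (by norm_num)) q hq θ₀ hθ₀
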